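/- Let $p$ be a prime and let $G$ be a (topologically) finitely generated pro-$p$ group. For a pro-$p$ group $H$ and $n \ge 1$, write $[H,H]$ for the closure of the commutator subgroup of $H$ and $H^n$ for the closure of the subgroup generated by all $n$-th powers of elements of $H$; call $H$ powerful if $p \ge 3$ and $[H,H] \le H^p$, or $p = 2$ and $[H,H] \le H^4$. Call $G$ hereditarily powerful if every open subgroup of $G$ is powerful. Theorem 1.11 (Lubotzky and Mann). The group $G$ is hereditarily powerful if and only if there exist a closed abelian normal subgroup $A$ of $G$, an element $b \in G$ and $s \in \{1,2,3,\dots\} \cup \{\infty\}$, with $s \ge 2$ if $p = 2$, such that $G = \overline{\langle b \rangle}\,A$ and $b$ acts on $A$ as multiplication by $1+p^s$ (with $A$ written additively), that is, $b^{-1} a b = a^{1+p^s}$ for all $a \in A$, where $p^\infty = 0$. -/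

import Mathlib

open scoped Pointwise

/-- A topological group is a pro-`p` group if it is profinite (compact, Hausdorff and totally
disconnected) and every open normal subgroup has index a power of `p`. -/
structure IsProP (p : ℕ) (G : Type*) [Group G] [TopologicalSpace G] [IsTopologicalGroup G] :
    Prop where
  compactSpace : CompactSpace G
  t2Space : T2Space G
  totallyDisconnectedSpace : TotallyDisconnectedSpace G
  index_eq_pow : ∀ U : Subgroup G, U.Normal → IsOpen (U : Set G) → ∃ n : ℕ, U.index = p ^ n

/-- Topological finite generation: some finite subset generates a dense subgroup. -/
def IsTopologicallyFG (G : Type*) [Group G] [TopologicalSpace G] [IsTopologicalGroup G] : Prop :=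
  ∃ S : Finset G, (Subgroup.closure (S : Set G)).topologicalClosure = ⊤

/-- `[G, G]`: the closure of the abstract commutator subgroup. -/
def closedCommutator (G : Type*) [Group G] [TopologicalSpace G] [IsTopologicalGroup G] :
    Subgroup G :=
  (commutator G).topologicalClosure

/-- `G ^ n`: the closure of the subgroup generated by all `n`-th powers. -/
def closedPower (G : Type*) [Group G] [TopologicalSpace G] [IsTopologicalGroup G] (n : ℕ) :
    Subgroup G :=
  (Subgroup.closure (Set.range fun g : G => g ^ n)).topologicalClosure

/-- The condition for a pro-`p` group to be powerful. -/
def IsPowerful (p : ℕ) (G : Type*) [Group G] [TopologicalSpace G] [IsTopologicalGroup G] : Prop :=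
  (3 ≤ p ∧ closedCommutator G ≤ closedPower G p) ∨
    (p = 2 ∧ closedCommutator G ≤ closedPower G 4)

/-- Every open subgroup (which is again a pro-`p` group when `G` is) is powerful. -/
def IsHereditarilyPowerful (p : ℕ) (G : Type*) [Group G] [TopologicalSpace G]
    [IsTopologicalGroup G] : Prop :=
  ∀ H : Subgroup G, IsOpen (H : Set G) → IsPowerful p H

/-- The number `1 + p ^ s` for `s ∈ ℕ ∪ {∞}`, where `p ^ ∞ = 0` (the `p`-adic limit). -/
def onePlusPow (p : ℕ) (s : ℕ∞) : ℕ :=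
  if s = ⊤ then 1 else 1 + p ^ s.toNat

/-- `b` acts on `A` (by conjugation) as multiplication by `1 + p ^ s`; in multiplicative notation,
`b⁻¹ a b = a ^ (1 + p ^ s)` for all `a ∈ A`. -/
def ActsAsOnePlusPow {G : Type*} [Group G] (p : ℕ) (b : G) (A : Subgroup G) (s : ℕ∞) : Prop :=
  ∀ a ∈ A, b⁻¹ * a * b = a ^ onePlusPow p s

/-! Put q = 4 if p = 2 and q = p otherwise. Both directions pass through the finite quotients of G
by open normal subgroups.

From a triple to powerfulness: since 1 + p^s is 1 modulo q, conjugation changes an element a of A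
only by the q-th power of a power of a. So, for a subgroup H of a finite quotient, the image of H ∩
A in H/H^q is central with cyclic quotient, and H/H^q is abelian (`IsModularTriple.commutator_mem`).

From powerfulness to a triple: every finite quotient is a p-group whose two-generated subgroups H
satisfy [H,H] ≤ H^q, and for such groups one proves Iwasawa's structure theorem
(`IsFinHerPowerful.hasPowerTriple`). Their power structure is nearly abelian: x ↦ x^(p^k) is
multiplicative on elements killed by p^(k+1) (`mul_pow_prime_pow`); if the exponent is p^(n+1), then
p^n-th powers are central (`pow_commute`); cyclic subgroups permute (`exists_zpow_mul_zpow`). The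
heart is `powConj_commute`: if b has maximal order, all elements on which b acts as the (t+1)-st
power commute. Hence A may be taken to be the set of all these elements, and it only remains to see
that they generate G together with b. This goes by induction on the order: divide by a central
subgroup ⟨ν⟩ of order p, with ν a p^n-th power, lift the triple of the quotient, and remove the
errors, which are powers of ν, by adjusting b, t or the elements of A.

A p-adic computation turns t + 1 into 1 + p^s at the price of replacing b by a power. Finally the
triples of the finite quotients converge along an ultrafilter, by compactness of G and of ℕ∞
(`exists_modular_of_forall_quotient`). -/

open scoped commutatorElement
open Filter Topology

universe u

/-- The exponent `p` (`p` odd) or `4` (`p = 2`) in the definition of a powerful pro-`p` group. -/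
def powerfulExponent (p : ℕ) : ℕ := if p = 2 then 4 else p

/-- A finite `p`-group all of whose two-generated subgroups `H` satisfy
`[H, H] ≤ H ^ powerfulExponent p`. -/
structure IsFinHerPowerful (p : ℕ) (G : Type u) [Group G] : Prop where
  prime : p.Prime
  finite : Finite G
  isPGroup : IsPGroup p G
  commutator_mem : ∀ x y : G, ⁅x, y⁆ ∈ Subgroup.closure
    ((fun g => g ^ powerfulExponent p) '' (Subgroup.closure {x, y} : Set G))

/-! ### Divisibility of binomial coefficients -/

section Arithmetic

variable {p : ℕ}

theorem dvd_powerfulExponent (p : ℕ) : p ∣ powerfulExponent p := by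
  unfold powerfulExponent
  split_ifs with h
  · subst h; decide
  · exact dvd_rfl

theorem dvd_choose_two_of_odd (hp : p.Prime) (h2 : p ≠ 2) {m : ℕ} (h : p ∣ m ∨ p ∣ m - 1) :
    p ∣ m.choose 2 := by
  have h1 : m.choose 2 * 2 = m * (m - 1) := by
    rw [Nat.choose_two_right]
    exact Nat.div_mul_cancel (Nat.even_mul_pred_self m).two_dvd
  have h3 : p ∣ m.choose 2 * 2 := by
    rw [h1]
    rcases h with h | h
    · exact h.mul_right _
    · exact h.mul_left _
  rcases hp.dvd_mul.1 h3 with h | h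
  · exact h
  · exact absurd ((Nat.prime_dvd_prime_iff_eq hp Nat.prime_two).1 h) h2

/-- This is one place where 2 must be replaced by 4: the number m(m-1) is twice the binomial
coefficient, so for p = 2 a factor 4 is needed. The second alternative serves exponents m = t + 1.
-/
theorem dvd_choose_two (hp : p.Prime) {m : ℕ}
    (h : powerfulExponent p ∣ m ∨ powerfulExponent p ∣ m - 1) : p ∣ m.choose 2 := by
  by_cases h2 : p = 2
  · subst h2
    have h1 : m.choose 2 * 2 = m * (m - 1) := by
      rw [Nat.choose_two_right]
      exact Nat.div_mul_cancel (Nat.even_mul_pred_self m).two_dvd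
    have h3 : 4 ∣ m.choose 2 * 2 := by
      rw [h1]
      rcases h with h | h
      · exact Dvd.dvd.mul_right h _
      · exact Dvd.dvd.mul_left h _
    omega
  · exact dvd_choose_two_of_odd hp h2
      (h.imp ((dvd_powerfulExponent p).trans) ((dvd_powerfulExponent p).trans))

end Arithmetic

/-! ### Powers of products with central commutator -/

section ClassTwo

variable {G : Type u} [Group G]

theorem mul_pow_of_commute_commutator {x y c : G} (h : y * x = x * y * c) (hx : Commute c x)
    (hy : Commute c y) (m : ℕ) : (x * y) ^ m = x ^ m * y ^ m * c ^ m.choose 2 := by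
  have key : ∀ m : ℕ, y ^ m * x = x * y ^ m * c ^ m := by
    intro m
    induction m with
    | zero => simp
    | succ m ih =>
      rw [pow_succ' y, mul_assoc, ih, ← mul_assoc, ← mul_assoc, h, pow_succ' c]
      have := (hy.pow_right m).eq
      simp only [mul_assoc]
      rw [← mul_assoc c (y ^ m), this]
      simp only [mul_assoc]
  induction m with
  | zero => simp
  | succ m ih =>
    have h1 : (m + 1).choose 2 = m + m.choose 2 := by
      rw [Nat.choose_succ_succ' m 1, Nat.choose_one_right]
    have h2 : Commute (c ^ m.choose 2) (x * y) := (hx.mul_right hy).pow_left _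
    rw [pow_succ, ih, mul_assoc, h2.eq, h1, pow_add c, pow_succ x, pow_succ y]
    calc x ^ m * y ^ m * (x * y * c ^ m.choose 2)
        = x ^ m * (y ^ m * x) * y * c ^ m.choose 2 := by simp only [mul_assoc]
      _ = x ^ m * x * y ^ m * (c ^ m * y) * c ^ m.choose 2 := by
          rw [key]; simp only [mul_assoc]
      _ = _ := by rw [(hy.pow_left m).eq]; simp only [mul_assoc]

theorem mul_pow_of_commutator_pow_eq_one {p : ℕ} {x y c : G} (h : y * x = x * y * c)
    (hx : Commute c x) (hy : Commute c y) (hc : c ^ p = 1) {m : ℕ} (hm : p ∣ m.choose 2) :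
    (x * y) ^ m = x ^ m * y ^ m := by
  rw [mul_pow_of_commute_commutator h hx hy]
  obtain ⟨k, hk⟩ := hm
  rw [hk, pow_mul, hc, one_pow, mul_one]

theorem commutator_mem_of_mem_closure_pair (N : Subgroup G) [N.Normal] {x y : G}
    (h : ⁅x, y⁆ ∈ N) {u v : G} (hu : u ∈ Subgroup.closure {x, y})
    (hv : v ∈ Subgroup.closure {x, y}) : ⁅u, v⁆ ∈ N := by
  have hxy : Commute (x : G ⧸ N) (y : G ⧸ N) := by
    rw [← commutatorElement_eq_one_iff_commute]
    exact (QuotientGroup.eq_one_iff (⁅x, y⁆)).2 h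
  have hc : ∀ a ∈ ({x, y} : Set G), ∀ b ∈ ({x, y} : Set G),
      Commute (a : G ⧸ N) (b : G ⧸ N) := by
    rintro a (rfl | rfl) b (rfl | rfl)
    exacts [Commute.refl _, hxy, hxy.symm, Commute.refl _]
  have hc1 : ∀ a ∈ ({x, y} : Set G), ∀ v ∈ Subgroup.closure {x, y},
      Commute (a : G ⧸ N) (v : G ⧸ N) := by
    intro a ha v hv
    induction hv using Subgroup.closure_induction with
    | mem b hb => exact hc a ha b hb
    | one => exact Commute.one_right _
    | mul b c _ _ h1 h2 => exact h1.mul_right h2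
    | inv b _ h1 => exact h1.inv_right
  have : Commute (u : G ⧸ N) (v : G ⧸ N) := by
    induction hu using Subgroup.closure_induction with
    | mem b hb => exact hc1 b hb v hv
    | one => exact Commute.one_left _
    | mul b c _ _ h1 h2 => exact h1.mul_left h2
    | inv b _ h1 => exact h1.inv_left
  rw [← QuotientGroup.eq_one_iff]
  exact commutatorElement_eq_one_iff_commute.2 this

end ClassTwo

/-! ### Power structure of finite hereditarily powerful groups -/

namespace IsFinHerPowerful

variable {p : ℕ} {G : Type u} [Group G]

theorem of_surjective {H : Type u} [Group H] (hG : IsFinHerPowerful p G) (f : G →* H)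
    (hf : Function.Surjective f) : IsFinHerPowerful p H where
  prime := hG.prime
  finite := have := hG.finite; Finite.of_surjective f hf
  isPGroup := hG.isPGroup.of_surjective f hf
  commutator_mem := by
    intro x y
    obtain ⟨x, rfl⟩ := hf x
    obtain ⟨y, rfl⟩ := hf y
    have h := Subgroup.mem_map_of_mem f (hG.commutator_mem x y)
    rw [map_commutatorElement, MonoidHom.map_closure] at h
    refine Subgroup.closure_mono ?_ h
    rintro _ ⟨_, ⟨g, hg, rfl⟩, rfl⟩
    refine ⟨f g, ?_, by simp⟩
    have := Subgroup.mem_map_of_mem f hg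
    rwa [MonoidHom.map_closure, Set.image_pair] at this

theorem quotient (hG : IsFinHerPowerful p G) (N : Subgroup G) [N.Normal] :
    IsFinHerPowerful p (G ⧸ N) :=
  hG.of_surjective (QuotientGroup.mk' N) (QuotientGroup.mk'_surjective N)

theorem subgroup (hG : IsFinHerPowerful p G) (K : Subgroup G) : IsFinHerPowerful p K where
  prime := hG.prime
  finite := have := hG.finite; inferInstance
  isPGroup := hG.isPGroup.to_subgroup K
  commutator_mem := by
    intro x y
    have h := hG.commutator_mem x y
    have e : Subgroup.closure {(x : G), (y : G)} =
        (Subgroup.closure {x, y}).map K.subtype := by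
      rw [MonoidHom.map_closure, Set.image_pair]; rfl
    have e2 : Subgroup.closure ((fun g => g ^ powerfulExponent p) ''
        (Subgroup.closure {(x : G), (y : G)} : Set G)) =
        (Subgroup.closure ((fun g => g ^ powerfulExponent p) ''
          (Subgroup.closure {x, y} : Set K))).map K.subtype := by
      rw [MonoidHom.map_closure, e, Subgroup.coe_map, Set.image_image, Set.image_image]
      rfl
    rw [e2] at h
    obtain ⟨z, hz, hz2⟩ := h
    have : z = ⁅x, y⁆ := Subtype.ext hz2
    rwa [← this]

theorem commute_of_forall_pow_eq_one (hG : IsFinHerPowerful p G) {x y : G}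
    (h : ∀ g ∈ Subgroup.closure {x, y}, g ^ powerfulExponent p = 1) : Commute x y := by
  have := hG.commutator_mem x y
  rw [← commutatorElement_eq_one_iff_commute, ← Subgroup.mem_bot]
  refine (Subgroup.closure_le (K := ⊥)).2 ?_ this
  rintro _ ⟨g, hg, rfl⟩
  exact h g hg

theorem exists_mem_center (hG : IsFinHerPowerful p G) [Nontrivial G] :
    ∃ z ∈ Subgroup.center G, z ≠ 1 ∧ z ^ p = 1 := by
  have := hG.finite
  have := Fact.mk hG.prime
  have := hG.isPGroup.center_nontrivial
  have hd : p ∣ Nat.card (Subgroup.center G) := by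
    obtain ⟨n, hn, hc⟩ := (hG.isPGroup.to_subgroup (Subgroup.center G)).nontrivial_iff_card.1 this
    rw [hc]; exact dvd_pow_self _ hn.ne'
  obtain ⟨z, hz⟩ := exists_prime_orderOf_dvd_card' p hd
  refine ⟨z, z.2, ?_, ?_⟩
  · intro h
    have : z = 1 := Subtype.ext h
    rw [this, orderOf_one] at hz
    exact hG.prime.one_lt.ne hz
  · have := pow_orderOf_eq_one z
    rw [hz] at this
    exact congrArg Subtype.val this

theorem card_quotient_lt [Finite G] (N : Subgroup G) (hN : N ≠ ⊥) :
    Nat.card (G ⧸ N) < Nat.card G := by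
  rw [N.card_eq_card_quotient_mul_card_subgroup]
  have h1 : 1 < Nat.card N := by
    by_contra h
    exact hN (N.eq_bot_of_card_le (not_lt.1 h))
  exact (Nat.lt_mul_iff_one_lt_right Nat.card_pos).2 h1

theorem quotient_induction {P : ∀ (G : Type u) [Group G], Prop}
    (step : ∀ (G : Type u) [Group G], IsFinHerPowerful p G →
      (∀ (N : Subgroup G) [N.Normal], N ≠ ⊥ → P (G ⧸ N)) → P G)
    (G : Type u) [Group G] (hG : IsFinHerPowerful p G) : P G := by
  induction h : Nat.card G using Nat.strong_induction_on generalizing G with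
  | _ n ih =>
    have := hG.finite
    refine step G hG fun N _ hN => ?_
    exact ih (Nat.card (G ⧸ N)) (h ▸ card_quotient_lt N hN) (G ⧸ N) (hG.quotient N) rfl

theorem normal_zpowers_of_mem_center {z : G} (hz : z ∈ Subgroup.center G) :
    (Subgroup.zpowers z).Normal :=
  ⟨fun n hn g => by
    rw [Subgroup.mem_center_iff.1 ((Subgroup.zpowers_le).2 hz hn) g, mul_inv_cancel_right]
    exact hn⟩

theorem eq_mul_commutator_inv (x y : G) : y * x = x * y * ⁅y⁻¹, x⁻¹⁆ := by
  simp [commutatorElement_def, mul_assoc]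

/-- By induction x and y commute modulo a central subgroup of order p. So ⟨x, y⟩ has class at most
two with commutators killed by p, its q-th power map is multiplicative and kills both generators,
and the hypothesis on ⟨x, y⟩ makes the commutator trivial. -/
theorem commute_of_pow_prime (hG : IsFinHerPowerful p G) {x y : G} (hx : x ^ p = 1)
    (hy : y ^ p = 1) : Commute x y := by
  refine quotient_induction (p := p) (P := fun G _ => ∀ x y : G, x ^ p = 1 → y ^ p = 1 →
    Commute x y) ?_ G hG x y hx hy
  intro G _ hG ih x y hx hy
  by_cases hn : Nontrivial G
  swap
  · have := not_nontrivial_iff_subsingleton.1 hn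
    exact Subsingleton.elim _ _
  obtain ⟨z, hz, hz1, hzp⟩ := hG.exists_mem_center
  have := normal_zpowers_of_mem_center hz
  have h1 := ih (Subgroup.zpowers z) (by simpa using hz1) x y
    (by rw [← QuotientGroup.mk_pow, hx]; rfl) (by rw [← QuotientGroup.mk_pow, hy]; rfl)
  have h2 : ⁅x, y⁆ ∈ Subgroup.zpowers z := by
    rw [← QuotientGroup.eq_one_iff]
    exact commutatorElement_eq_one_iff_commute.2 h1
  have hcen : ∀ c ∈ Subgroup.zpowers z, (∀ g, Commute c g) ∧ c ^ p = 1 := by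
    intro c hc
    refine ⟨fun g => ((Subgroup.mem_center_iff.1 ((Subgroup.zpowers_le).2 hz hc)) g).symm, ?_⟩
    obtain ⟨k, rfl⟩ := hc
    simp only
    rw [← zpow_natCast, zpow_comm, zpow_natCast, hzp, one_zpow]
  have hq : p ∣ (powerfulExponent p).choose 2 := dvd_choose_two hG.prime (Or.inl dvd_rfl)
  refine hG.commute_of_forall_pow_eq_one ?_
  have hmul : ∀ u ∈ Subgroup.closure {x, y}, ∀ v ∈ Subgroup.closure {x, y},
      (u * v) ^ powerfulExponent p = u ^ powerfulExponent p * v ^ powerfulExponent p := by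
    intro u hu v hv
    have := commutator_mem_of_mem_closure_pair _ h2 (inv_mem hv) (inv_mem hu)
    exact mul_pow_of_commutator_pow_eq_one (eq_mul_commutator_inv u v) ((hcen _ this).1 u)
      ((hcen _ this).1 v) (hcen _ this).2 hq
  intro g hg
  induction hg using Subgroup.closure_induction with
  | mem a ha =>
    obtain ⟨k, hk⟩ := dvd_powerfulExponent p
    rw [hk, pow_mul]
    rcases ha with rfl | rfl
    · rw [hx, one_pow]
    · rw [hy, one_pow]
  | one => simp
  | mul a b ha hb iha ihb => rw [hmul a ha b hb, iha, ihb, one_mul]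
  | inv a ha iha => rw [inv_pow, iha, inv_one]

/-- The subgroup of elements of order dividing `p`. -/
def omega (hG : IsFinHerPowerful p G) : Subgroup G where
  carrier := {x | x ^ p = 1}
  one_mem' := one_pow p
  mul_mem' := by
    intro a b ha hb
    simp only [Set.mem_ofPred_eq] at *
    rw [(hG.commute_of_pow_prime ha hb).mul_pow, ha, hb, one_mul]
  inv_mem' := by
    intro a ha
    simp only [Set.mem_ofPred_eq] at *
    rw [inv_pow, ha, inv_one]

theorem mem_omega (hG : IsFinHerPowerful p G) {x : G} : x ∈ hG.omega ↔ x ^ p = 1 := Iff.rfl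

instance omega_normal (hG : IsFinHerPowerful p G) : hG.omega.Normal where
  conj_mem := by
    intro x hx g
    rw [mem_omega] at *
    rw [conj_pow, hx, mul_one, mul_inv_cancel]

/-- Dividing by the elements killed by p lowers the exponent by one step; the inductions on k below
rest on this. -/
theorem mk_pow_eq_one (hG : IsFinHerPowerful p G) {x : G} {k : ℕ} :
    (x : G ⧸ hG.omega) ^ p ^ k = 1 ↔ x ^ p ^ (k + 1) = 1 := by
  rw [← QuotientGroup.mk_pow, QuotientGroup.eq_one_iff, mem_omega, ← pow_mul, ← pow_succ]

theorem mul_pow_eq_one (k : ℕ) : ∀ {G : Type u} [Group G], IsFinHerPowerful p G → ∀ {x y : G},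
    x ^ p ^ k = 1 → y ^ p ^ k = 1 → (x * y) ^ p ^ k = 1 := by
  induction k with
  | zero => intro G _ hG x y hx hy; simp_all
  | succ k ih =>
    intro G _ hG x y hx hy
    have := ih (hG.quotient hG.omega) (hG.mk_pow_eq_one.2 hx) (hG.mk_pow_eq_one.2 hy)
    rw [← QuotientGroup.mk_mul] at this
    exact hG.mk_pow_eq_one.1 this

theorem closure_pow_eq_one (hG : IsFinHerPowerful p G) (k : ℕ) {S : Set G}
    (hS : ∀ s ∈ S, s ^ p ^ k = 1) {g : G} (hg : g ∈ Subgroup.closure S) : g ^ p ^ k = 1 := by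
  induction hg using Subgroup.closure_induction with
  | mem a ha => exact hS a ha
  | one => simp
  | mul a b ha hb iha ihb => exact mul_pow_eq_one k hG iha ihb
  | inv a ha iha => rw [inv_pow, iha, inv_one]

theorem commutator_mem_omega (hG : IsFinHerPowerful p G) {x y : G} (hx : x ^ p ^ 2 = 1)
    (hy : y ^ p ^ 2 = 1) : ⁅x, y⁆ ∈ hG.omega := by
  have h1 : Commute (x : G ⧸ hG.omega) (y : G ⧸ hG.omega) :=
    (hG.quotient hG.omega).commute_of_pow_prime
      (by have := hG.mk_pow_eq_one (x := x) (k := 1); rw [pow_one] at this; exact this.2 hx)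
      (by have := hG.mk_pow_eq_one (x := y) (k := 1); rw [pow_one] at this; exact this.2 hy)
  rw [← QuotientGroup.eq_one_iff]
  exact commutatorElement_eq_one_iff_commute.2 h1

/-- For `p = 2`, elements of order dividing `4` commute. -/
theorem commute_of_pow_four (hG : IsFinHerPowerful p G) (h2 : p = 2) {x y : G}
    (hx : x ^ p ^ 2 = 1) (hy : y ^ p ^ 2 = 1) : Commute x y := by
  refine hG.commute_of_forall_pow_eq_one fun g hg => ?_
  have := hG.closure_pow_eq_one 2 (S := {x, y}) (by rintro s (rfl | rfl) <;> assumption) hg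
  subst h2
  simpa [powerfulExponent] using this

/-- For odd p, x^p is central in X = ⟨x, w⟩, and modulo ⟨x^p⟩ both generators are killed by p, hence
commute. So their commutator lies in ⟨x^p⟩, central and killed by p, and the class-two formula
applies. -/
theorem mul_omega_pow (hG : IsFinHerPowerful p G) {x w : G} (hx : x ^ p ^ 2 = 1)
    (hw : w ^ p = 1) : (x * w) ^ p = x ^ p := by
  have hw2 : w ^ p ^ 2 = 1 := by rw [pow_two, pow_mul, hw, one_pow]
  by_cases h2 : p = 2
  · rw [(hG.commute_of_pow_four h2 hx hw2).mul_pow, hw, mul_one]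
  have hxp : (x ^ p) ^ p = 1 := by rw [← pow_mul, ← pow_two, hx]
  have hcx : Commute (x ^ p) w := hG.commute_of_pow_prime hxp hw
  set X := Subgroup.closure {x, w}
  have hxX : x ∈ X := Subgroup.subset_closure (by simp)
  have hwX : w ∈ X := Subgroup.subset_closure (by simp)
  let x' : X := ⟨x, hxX⟩
  let w' : X := ⟨w, hwX⟩
  have hcen : x' ^ p ∈ Subgroup.center X := by
    rw [Subgroup.mem_center_iff]
    rintro ⟨g, hg⟩
    apply Subtype.ext
    change g * x ^ p = x ^ p * g
    have : g ∈ Subgroup.centralizer {x ^ p} := by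
      refine (Subgroup.closure_le _).2 ?_ hg
      rintro s (rfl | rfl)
      · exact Subgroup.mem_centralizer_singleton_iff.2 (Commute.self_pow s p)
      · exact Subgroup.mem_centralizer_singleton_iff.2 hcx.symm
    exact Subgroup.mem_centralizer_singleton_iff.1 this
  have hnor := normal_zpowers_of_mem_center hcen
  have hXp := (hG.subgroup X).quotient (Subgroup.zpowers (x' ^ p))
  have hcomm : Commute (w' : X ⧸ Subgroup.zpowers (x' ^ p)) (x' : X ⧸ Subgroup.zpowers (x' ^ p)) := by
    apply hXp.commute_of_pow_prime
    · rw [← QuotientGroup.mk_pow]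
      have : w' ^ p = 1 := Subtype.ext hw
      rw [this]; rfl
    · rw [← QuotientGroup.mk_pow, QuotientGroup.eq_one_iff]
      exact Subgroup.mem_zpowers _
  have hc : ⁅w'⁻¹, x'⁻¹⁆ ∈ Subgroup.zpowers (x' ^ p) := by
    rw [← QuotientGroup.eq_one_iff]
    exact commutatorElement_eq_one_iff_commute.2 (hcomm.inv_inv)
  have hc2 : ⁅w'⁻¹, x'⁻¹⁆ ∈ Subgroup.center X := (Subgroup.zpowers_le).2 hcen hc
  have hcp : ⁅w'⁻¹, x'⁻¹⁆ ^ p = 1 := by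
    obtain ⟨k, hk⟩ := hc
    simp only at hk
    have : (x' ^ p) ^ p = 1 := Subtype.ext hxp
    rw [← hk, ← zpow_natCast, zpow_comm, zpow_natCast, this, one_zpow]
  have := mul_pow_of_commutator_pow_eq_one (eq_mul_commutator_inv x' w')
    ((Subgroup.mem_center_iff.1 hc2 _).symm) ((Subgroup.mem_center_iff.1 hc2 _).symm) hcp
    (dvd_choose_two_of_odd hG.prime h2 (Or.inl dvd_rfl))
  have := congrArg Subtype.val this
  change (x * w) ^ p = x ^ p * w ^ p at this
  rw [this, hw, mul_one]

/-- For odd p, conjugation by y multiplies x by an element killed by p, which does not change x^p;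
so p-th powers commute with all elements killed by p². Commutators are products of such p-th powers,
hence central enough for the class-two formula. -/
theorem mul_pow_prime (hG : IsFinHerPowerful p G) {x y : G} (hx : x ^ p ^ 2 = 1)
    (hy : y ^ p ^ 2 = 1) : (x * y) ^ p = x ^ p * y ^ p := by
  by_cases h2 : p = 2
  · exact (hG.commute_of_pow_four h2 hx hy).mul_pow p
  have hcomm : ∀ {x y : G}, x ^ p ^ 2 = 1 → y ^ p ^ 2 = 1 → Commute (x ^ p) y := by
    intro x y hx hy
    have h1 : y⁻¹ * x * y = x * ⁅x⁻¹, y⁻¹⁆ := by simp [commutatorElement_def, mul_assoc]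
    have h3 : (y⁻¹ * x * y) ^ p = x ^ p := by
      rw [h1]
      exact hG.mul_omega_pow hx
        (hG.commutator_mem_omega (by rw [inv_pow, hx, inv_one]) (by rw [inv_pow, hy, inv_one]))
    have h4 : (y⁻¹ * x * y) ^ p = y⁻¹ * x ^ p * y := by
      have := conj_pow (i := p) (a := y⁻¹) (b := x)
      rwa [inv_inv] at this
    rw [h4] at h3
    calc x ^ p * y = y * (y⁻¹ * x ^ p * y) := by group
      _ = y * x ^ p := by rw [h3]
  have hq : powerfulExponent p = p := if_neg h2
  have hmem : ∀ {x y g : G}, x ^ p ^ 2 = 1 → y ^ p ^ 2 = 1 → g ^ p ^ 2 = 1 →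
      Commute ⁅x, y⁆ g := by
    intro x y g hx hy hg
    have h := hG.commutator_mem x y
    rw [hq] at h
    have : ⁅x, y⁆ ∈ Subgroup.centralizer {g} := by
      refine (Subgroup.closure_le _).2 ?_ h
      rintro _ ⟨a, ha, rfl⟩
      have ha2 := hG.closure_pow_eq_one 2 (S := {x, y}) (by rintro s (rfl | rfl) <;> assumption) ha
      exact Subgroup.mem_centralizer_singleton_iff.2 (hcomm ha2 hg)
    exact Subgroup.mem_centralizer_singleton_iff.1 this
  have hx' : x⁻¹ ^ p ^ 2 = 1 := by rw [inv_pow, hx, inv_one]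
  have hy' : y⁻¹ ^ p ^ 2 = 1 := by rw [inv_pow, hy, inv_one]
  exact mul_pow_of_commutator_pow_eq_one (eq_mul_commutator_inv x y) (hmem hy' hx' hx)
    (hmem hy' hx' hy) (hG.commutator_mem_omega hy' hx')
    (dvd_choose_two_of_odd hG.prime h2 (Or.inl dvd_rfl))

/-- On elements of order dividing `p ^ (k + 1)`, raising to the power `p ^ k` is multiplicative. -/
theorem mul_pow_prime_pow (k : ℕ) : ∀ {G : Type u} [Group G], IsFinHerPowerful p G → ∀ {x y : G},
    x ^ p ^ (k + 1) = 1 → y ^ p ^ (k + 1) = 1 →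
    (x * y) ^ p ^ k = x ^ p ^ k * y ^ p ^ k := by
  induction k with
  | zero => intro G _ hG x y hx hy; simp
  | succ k ih =>
    intro G _ hG x y hx hy
    have h := ih (hG.quotient hG.omega) (hG.mk_pow_eq_one.2 hx) (hG.mk_pow_eq_one.2 hy)
    simp only [← QuotientGroup.mk_mul, ← QuotientGroup.mk_pow] at h
    rw [eq_comm, QuotientGroup.eq] at h
    have hX : (x ^ p ^ k) ^ p ^ 2 = 1 := by rw [← pow_mul, ← pow_add]; exact hx
    have hY : (y ^ p ^ k) ^ p ^ 2 = 1 := by rw [← pow_mul, ← pow_add]; exact hy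
    have h1 := hG.mul_omega_pow (mul_pow_eq_one 2 hG hX hY) h
    rw [mul_inv_cancel_left, hG.mul_pow_prime hX hY, ← pow_mul, ← pow_mul, ← pow_mul,
      ← pow_succ] at h1
    exact h1

/-- A commutator is a product of q-th powers and p divides q, so it is killed by p^n. Conjugating x
by y multiplies x by a commutator, and multiplicativity of the p^n-th power shows x^(p^n) unchanged.
-/
theorem pow_commute (hG : IsFinHerPowerful p G) {n : ℕ} (hexp : ∀ g : G, g ^ p ^ (n + 1) = 1)
    (x y : G) : Commute (x ^ p ^ n) y := by
  have h1 : ⁅x⁻¹, y⁻¹⁆ ^ p ^ n = 1 := by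
    refine hG.closure_pow_eq_one n ?_ (hG.commutator_mem x⁻¹ y⁻¹)
    rintro _ ⟨g, -, rfl⟩
    obtain ⟨k, hk⟩ := dvd_powerfulExponent p
    simp only
    rw [← pow_mul, hk, show p * k * p ^ n = p ^ (n + 1) * k by ring, pow_mul, hexp, one_pow]
  have h2 : y⁻¹ * x * y = x * ⁅x⁻¹, y⁻¹⁆ := by simp [commutatorElement_def, mul_assoc]
  have h3 : (y⁻¹ * x * y) ^ p ^ n = x ^ p ^ n := by
    rw [h2, mul_pow_prime_pow n hG (hexp _) (hexp _), h1, mul_one]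
  have h4 : (y⁻¹ * x * y) ^ p ^ n = y⁻¹ * x ^ p ^ n * y := by
    have := conj_pow (i := p ^ n) (a := y⁻¹) (b := x)
    rwa [inv_inv] at this
  rw [h4] at h3
  calc x ^ p ^ n * y = y * (y⁻¹ * x ^ p ^ n * y) := by group
    _ = y * x ^ p ^ n := by rw [h3]

end IsFinHerPowerful

/-! ### Permuting cyclic subgroups and independence of socles -/

section Auxiliary

variable {G : Type u} [Group G]

theorem pow_mul_eq_of_commute_commutator {x y c : G} (h : y * x = x * y * c)
    (hy : Commute c y) (m : ℕ) : y ^ m * x = x * y ^ m * c ^ m := by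
  induction m with
  | zero => simp
  | succ m ih =>
    calc y ^ (m + 1) * x = y * (y ^ m * x) := by rw [pow_succ', mul_assoc]
      _ = y * x * y ^ m * c ^ m := by rw [ih]; simp only [mul_assoc]
      _ = x * y * (c * y ^ m) * c ^ m := by rw [h]; simp only [mul_assoc]
      _ = x * y ^ (m + 1) * c ^ (m + 1) := by
        rw [(hy.pow_right m).eq, pow_succ' y, pow_succ' c]; simp only [mul_assoc]

theorem mul_pow_eq_of_commute_commutator {x y c : G} (h : y * x = x * y * c)
    (hx : Commute c x) (m : ℕ) : y * x ^ m = x ^ m * y * c ^ m := by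
  induction m with
  | zero => simp
  | succ m ih =>
    calc y * x ^ (m + 1) = y * x ^ m * x := by rw [pow_succ, mul_assoc]
      _ = x ^ m * y * (c ^ m * x) := by rw [ih]; simp only [mul_assoc]
      _ = x ^ m * (y * x) * c ^ m := by rw [(hx.pow_left m).eq]; simp only [mul_assoc]
      _ = x ^ (m + 1) * y * c ^ (m + 1) := by
        rw [h, pow_succ, pow_succ' c]; simp only [mul_assoc]

theorem zpow_eq_one_of_mem {p : ℕ} (hp : p.Prime) {x : G} (hx : x ^ p = 1) {H : Subgroup G}
    (hH : x ∉ H) {i : ℤ} (hi : x ^ i ∈ H) : x ^ i = 1 := by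
  by_cases hd : (p : ℤ) ∣ i
  · obtain ⟨k, rfl⟩ := hd
    rw [zpow_mul, zpow_natCast, hx, one_zpow]
  · exfalso
    apply hH
    have hc : IsCoprime (p : ℤ) i := ((Nat.prime_iff_prime_int.1 hp).coprime_iff_not_dvd).2 hd
    obtain ⟨r, s, hrs⟩ := hc
    have : x = (x ^ i) ^ s := by
      rw [← zpow_mul]
      calc x = x ^ (r * p + s * i) := by rw [hrs, zpow_one]
        _ = x ^ (i * s) := by
          rw [zpow_add, mul_comm r, zpow_mul, zpow_natCast, hx, one_zpow, one_mul, mul_comm]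
    rw [this]
    exact H.zpow_mem hi s

theorem mem_zpowers_pow_of_pow_eq_one {p k : ℕ} (hp : p.Prime) {x a : G}
    (hx : orderOf x = p ^ (k + 1)) (ha : a ∈ Subgroup.zpowers x) (hap : a ^ p = 1) :
    a ∈ Subgroup.zpowers (x ^ p ^ k) := by
  obtain ⟨i, rfl⟩ := ha
  simp only at hap ⊢
  rw [← zpow_natCast, ← zpow_mul, ← orderOf_dvd_iff_zpow_eq_one, hx, pow_succ, Nat.cast_mul] at hap
  obtain ⟨j, rfl⟩ := Int.dvd_of_mul_dvd_mul_right (by exact_mod_cast hp.ne_zero) hap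
  refine ⟨j, ?_⟩
  simp only
  rw [zpow_mul, zpow_natCast]

theorem exists_npow_eq_zpow [Finite G] (x : G) (i : ℤ) : ∃ j : ℕ, x ^ j = x ^ i :=
  (mem_powers_iff_mem_zpowers).2 ⟨i, rfl⟩

end Auxiliary

namespace IsFinHerPowerful

variable {p : ℕ} {G : Type u} [Group G]

theorem exists_exponent (hG : IsFinHerPowerful p G) :
    ∃ k, (∀ g : G, g ^ p ^ k = 1) ∧ ∀ j < k, ∃ g : G, g ^ p ^ j ≠ 1 := by
  classical
  have := hG.finite
  have := Fact.mk hG.prime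
  have h : ∃ k, ∀ g : G, g ^ p ^ k = 1 := by
    obtain ⟨k, hk⟩ := IsPGroup.iff_card.1 hG.isPGroup
    exact ⟨k, fun g => by rw [← hk]; exact pow_card_eq_one'⟩
  refine ⟨Nat.find h, Nat.find_spec h, fun j hj => ?_⟩
  have := Nat.find_min h hj
  push Not at this
  exact this

theorem exists_orderOf (hG : IsFinHerPowerful p G) {x : G} (hx : x ≠ 1) :
    ∃ k, orderOf x = p ^ (k + 1) := by
  have := Fact.mk hG.prime
  obtain ⟨k, hk⟩ := IsPGroup.iff_orderOf.1 hG.isPGroup x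
  cases k with
  | zero => rw [pow_zero, orderOf_eq_one_iff] at hk; exact absurd hk hx
  | succ k => exact ⟨k, hk⟩

/-- One of the two generators has a nontrivial p^n-th power, which is central. Induction applies
modulo it, and the error, being a power of x or of y, is absorbed into the corresponding factor. -/
theorem exists_zpow_mul_zpow_of_closure_eq_top (hG : IsFinHerPowerful p G) {x y : G}
    (h : Subgroup.closure {x, y} = ⊤) (g : G) : ∃ i j : ℤ, g = x ^ i * y ^ j := by
  refine quotient_induction (p := p) (P := fun G _ => ∀ x y : G, Subgroup.closure {x, y} = ⊤ →
    ∀ g : G, ∃ i j : ℤ, g = x ^ i * y ^ j) ?_ G hG x y h g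
  intro G _ hG ih x y hxy g
  obtain ⟨k, hk, hk2⟩ := hG.exists_exponent
  cases k with
  | zero => exact ⟨0, 0, by simpa using hk g⟩
  | succ n =>
    have hcen : ∀ z : G, z ^ p ^ n ∈ Subgroup.center G := fun z =>
      Subgroup.mem_center_iff.2 fun g => (hG.pow_commute hk z g).symm.eq
    have key : ∀ z : G, z ^ p ^ n ≠ 1 → ∃ i j l : ℤ, g = x ^ i * y ^ j * (z ^ p ^ n) ^ l := by
      intro z hz
      have := normal_zpowers_of_mem_center (hcen z)
      have hcl : Subgroup.closure {(x : G ⧸ Subgroup.zpowers (z ^ p ^ n)),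
          (y : G ⧸ Subgroup.zpowers (z ^ p ^ n))} = ⊤ := by
        have h := congrArg (Subgroup.map (QuotientGroup.mk' (Subgroup.zpowers (z ^ p ^ n)))) hxy
        rwa [MonoidHom.map_closure, Set.image_pair,
          Subgroup.map_top_of_surjective _ (QuotientGroup.mk'_surjective _)] at h
      obtain ⟨i, j, hij⟩ := ih (Subgroup.zpowers (z ^ p ^ n))
        (by simpa using hz) x y hcl (g : G ⧸ Subgroup.zpowers (z ^ p ^ n))
      rw [← QuotientGroup.mk_zpow, ← QuotientGroup.mk_zpow, ← QuotientGroup.mk_mul, eq_comm,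
        QuotientGroup.eq] at hij
      obtain ⟨l, hl⟩ := hij
      refine ⟨i, j, l, ?_⟩
      simp only at hl
      rw [hl, mul_inv_cancel_left]
    have : x ^ p ^ n ≠ 1 ∨ y ^ p ^ n ≠ 1 := by
      by_contra hcon
      push Not at hcon
      obtain ⟨z, hz⟩ := hk2 n (Nat.lt_succ_self n)
      exact hz (hG.closure_pow_eq_one n (S := {x, y}) (by
        rintro s (rfl | rfl)
        exacts [hcon.1, hcon.2]) (hxy ▸ Subgroup.mem_top z))
    rcases this with h | h
    · obtain ⟨i, j, l, hl⟩ := key x h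
      refine ⟨i + (p ^ n : ℕ) * l, j, ?_⟩
      have hc : Commute ((x ^ p ^ n) ^ l) (y ^ j) :=
        ((hG.pow_commute hk x y).zpow_left l).zpow_right j
      rw [hl, zpow_add, zpow_mul, zpow_natCast, mul_assoc, mul_assoc, hc.eq]
    · obtain ⟨i, j, l, hl⟩ := key y h
      refine ⟨i, j + (p ^ n : ℕ) * l, ?_⟩
      rw [hl, zpow_add, zpow_mul, zpow_natCast, mul_assoc]

/-- Cyclic subgroups permute. -/
theorem exists_zpow_mul_zpow (hG : IsFinHerPowerful p G) {x y g : G}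
    (hg : g ∈ Subgroup.closure {x, y}) : ∃ i j : ℤ, g = x ^ i * y ^ j := by
  set X := Subgroup.closure {x, y} with hX
  have hxX : x ∈ X := Subgroup.subset_closure (by simp)
  have hyX : y ∈ X := Subgroup.subset_closure (by simp)
  have hcl : Subgroup.closure {(⟨x, hxX⟩ : X), ⟨y, hyX⟩} = ⊤ := by
    apply Subgroup.map_injective X.subtype_injective
    rw [MonoidHom.map_closure, Set.image_pair, ← MonoidHom.range_eq_map, Subgroup.range_subtype]
    rfl
  obtain ⟨i, j, h⟩ := (hG.subgroup X).exists_zpow_mul_zpow_of_closure_eq_top hcl ⟨g, hg⟩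
  exact ⟨i, j, congrArg Subtype.val h⟩

/-- Descend on the power of p killing both factors: multiplicativity of the next lower power places
the power of a in H ⊓ K, so it is trivial, and then so is that of d. -/
theorem pow_prime_eq_one_of_mul (hG : IsFinHerPowerful p G) {H K : Subgroup G} (hHK : H ⊓ K = ⊥)
    {a d : G} (ha : a ∈ H) (hd : d ∈ K) (h : (a * d) ^ p = 1) : a ^ p = 1 ∧ d ^ p = 1 := by
  have key : ∀ k, a ^ p ^ (k + 1) = 1 → d ^ p ^ (k + 1) = 1 → a ^ p = 1 ∧ d ^ p = 1 := by
    intro k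
    induction k with
    | zero => intro h1 h2; simp_all
    | succ k ih =>
      intro h1 h2
      have h3 := mul_pow_prime_pow (k + 1) hG h1 h2
      rw [pow_succ' p k, pow_mul, h, one_pow, ← pow_succ' p k] at h3
      have h4 : a ^ p ^ (k + 1) ∈ H ⊓ K := by
        refine ⟨H.pow_mem ha _, ?_⟩
        rw [eq_inv_of_mul_eq_one_left h3.symm]
        exact K.inv_mem (K.pow_mem hd _)
      rw [hHK, Subgroup.mem_bot] at h4
      rw [h4, one_mul] at h3
      exact ih h4 h3.symm
  obtain ⟨k, hk, -⟩ := hG.exists_exponent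
  refine key k ?_ ?_ <;> rw [pow_succ, pow_mul, hk, one_pow]

/-- Independence of the subgroups of order p forces ⟨u⟩ ∩ ⟨v⟩ = 1. Writing c as a power of u times a
power of v, both factors are then killed by p. -/
theorem exists_socle_of_mem_closure (hG : IsFinHerPowerful p G) {u v c : G} {k m : ℕ}
    (hu : orderOf u = p ^ (k + 1)) (hv : orderOf v = p ^ (m + 1))
    (hind : v ^ p ^ m ∉ Subgroup.zpowers (u ^ p ^ k)) (hc : c ∈ Subgroup.closure {u, v})
    (hcp : c ^ p = 1) : ∃ i j : ℤ, c = (u ^ p ^ k) ^ i * (v ^ p ^ m) ^ j := by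
  have hbot : Subgroup.zpowers u ⊓ Subgroup.zpowers v = ⊥ := by
    rw [Subgroup.eq_bot_iff_forall]
    intro g hg
    by_contra hg1
    obtain ⟨r, hr⟩ := hG.exists_orderOf hg1
    have h1 : (g ^ p ^ r) ^ p = 1 := by rw [← pow_mul, ← pow_succ, ← hr, pow_orderOf_eq_one]
    have h2 : g ^ p ^ r ≠ 1 := by
      intro h
      have := orderOf_dvd_of_pow_eq_one h
      rw [hr, Nat.pow_dvd_pow_iff_le_right hG.prime.one_lt] at this
      omega
    have h3 := mem_zpowers_pow_of_pow_eq_one hG.prime hu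
      ((Subgroup.zpowers u).pow_mem hg.1 (p ^ r)) h1
    have h4 := mem_zpowers_pow_of_pow_eq_one hG.prime hv
      ((Subgroup.zpowers v).pow_mem hg.2 (p ^ r)) h1
    obtain ⟨j, hj⟩ := h4
    simp only at hj
    rw [← hj] at h3 h2
    have hv1 : (v ^ p ^ m) ^ p = 1 := by rw [← pow_mul, ← pow_succ, ← hv, pow_orderOf_eq_one]
    exact h2 (zpow_eq_one_of_mem hG.prime hv1 hind h3)
  obtain ⟨i, j, rfl⟩ := hG.exists_zpow_mul_zpow hc
  have hi : u ^ i ∈ Subgroup.zpowers u := ⟨i, rfl⟩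
  have hj : v ^ j ∈ Subgroup.zpowers v := ⟨j, rfl⟩
  obtain ⟨h1, h2⟩ := hG.pow_prime_eq_one_of_mul hbot hi hj hcp
  obtain ⟨i', hi'⟩ := mem_zpowers_pow_of_pow_eq_one hG.prime hu hi h1
  obtain ⟨j', hj'⟩ := mem_zpowers_pow_of_pow_eq_one hG.prime hv hj h2
  exact ⟨i', j', by simp only at hi' hj'; rw [hi', hj']⟩

/-- In X = ⟨x, y⟩ the p-th powers of the generators are central, so X modulo its centre is generated
by two elements killed by p, which commute. Hence c is central in X, and y^p commuting with x gives
c^p = 1. -/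
theorem commute_commutator_of_pow_commute (hG : IsFinHerPowerful p G) {x y c : G}
    (h : y * x = x * y * c) (hx : Commute (x ^ p) y) (hy : Commute (y ^ p) x) :
    Commute c x ∧ Commute c y ∧ c ^ p = 1 := by
  set X := Subgroup.closure {x, y} with hX
  have hxX : x ∈ X := Subgroup.subset_closure (by simp)
  have hyX : y ∈ X := Subgroup.subset_closure (by simp)
  have hcX : c ∈ X := by
    rw [← inv_mul_eq_iff_eq_mul] at h
    rw [← h]
    exact X.mul_mem (X.inv_mem (X.mul_mem hxX hyX)) (X.mul_mem hyX hxX)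
  have hcen : ∀ g : X, Commute (g : G) x → Commute (g : G) y → g ∈ Subgroup.center X := by
    intro g h1 h2
    rw [Subgroup.mem_center_iff]
    rintro ⟨a, ha⟩
    apply Subtype.ext
    have : a ∈ Subgroup.centralizer {(g : G)} := by
      refine (Subgroup.closure_le _).2 ?_ ha
      rintro s (rfl | rfl)
      · exact Subgroup.mem_centralizer_singleton_iff.2 h1.symm
      · exact Subgroup.mem_centralizer_singleton_iff.2 h2.symm
    exact Subgroup.mem_centralizer_singleton_iff.1 this
  have h1 := hcen (⟨x, hxX⟩ ^ p) (Commute.pow_self x p) hx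
  have h2 := hcen (⟨y, hyX⟩ ^ p) hy (Commute.pow_self y p)
  have h3 : Commute ((⟨x, hxX⟩ : X) : X ⧸ Subgroup.center X)
      ((⟨y, hyX⟩ : X) : X ⧸ Subgroup.center X) :=
    ((hG.subgroup X).quotient _).commute_of_pow_prime
      ((QuotientGroup.eq_one_iff _).2 h1) ((QuotientGroup.eq_one_iff _).2 h2)
  have h4 : (⟨c, hcX⟩ : X) ∈ Subgroup.center X := by
    rw [← QuotientGroup.eq_one_iff]
    have : (⟨y, hyX⟩ : X) * ⟨x, hxX⟩ = ⟨x, hxX⟩ * ⟨y, hyX⟩ * ⟨c, hcX⟩ := Subtype.ext h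
    have := congrArg (QuotientGroup.mk' (Subgroup.center X)) this
    simp only [map_mul, QuotientGroup.mk'_apply] at this
    rw [h3.eq] at this
    exact (mul_eq_left.1 this.symm)
  rw [Subgroup.mem_center_iff] at h4
  have hcx : Commute c x := (congrArg Subtype.val (h4 ⟨x, hxX⟩)).symm
  have hcy : Commute c y := (congrArg Subtype.val (h4 ⟨y, hyX⟩)).symm
  refine ⟨hcx, hcy, ?_⟩
  have := pow_mul_eq_of_commute_commutator h hcy p
  rw [hy.eq] at this
  exact mul_eq_left.1 this.symm

end IsFinHerPowerful

/-! ### Elements on which b acts as a power map -/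

/-- `b` conjugates `y` to `y ^ (t + 1)`. -/
def PowConj {G : Type u} [Group G] (b : G) (t : ℕ) (y : G) : Prop := y * b = b * y ^ (t + 1)

section Arithmetic

/-- Each p-th power of a number congruent to 1 gains at least one factor p in its distance to 1. For
this inequality p ∣ t suffices, also when p = 2. -/
theorem pow_dvd_add_one_pow_sub_one {p : ℕ} {t : ℕ} (ht : p ∣ t) {α n : ℕ}
    (h : p ^ n ∣ α * t) (hp : p.Prime) : (t + 1) ^ α ≡ 1 [MOD p ^ n] := by
  have key : ∀ e j : ℕ, 1 ≤ e → p ^ e ∣ t → (t + 1) ^ p ^ j ≡ 1 [MOD p ^ (e + j)] := by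
    intro e j he h
    have h1 : ((p ^ e : ℕ) : ℤ) ∣ ((t + 1 : ℕ) : ℤ) - 1 := by
      push_cast
      rw [add_sub_cancel_right]
      exact_mod_cast h
    have : ∀ j, ((p ^ (e + j) : ℕ) : ℤ) ∣ ((t + 1 : ℕ) : ℤ) ^ p ^ j - 1 := by
      intro j
      induction j with
      | zero => simpa using h1
      | succ j ih =>
        obtain ⟨z, hz⟩ := ih
        have h2 : ((t + 1 : ℕ) : ℤ) ^ p ^ j = 1 + (p ^ (e + j) : ℕ) * z := by linarith
        rw [pow_succ p j, pow_mul, h2, ← add_assoc]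
        have h4 : ∃ w : ℤ, (1 + (p ^ (e + j) : ℕ) * z) ^ p =
            1 + p * ((p ^ (e + j) : ℕ) * z) + ((p ^ (e + j) : ℕ) * z) ^ 2 * w := by
          obtain ⟨w, hw⟩ := Polynomial.powAddExpansion (1 : ℤ) ((p ^ (e + j) : ℕ) * z) p
          refine ⟨w, ?_⟩
          rw [hw]; simp; ring
        obtain ⟨w, hw⟩ := h4
        rw [hw]
        have h5 : ((p ^ (e + j + 1) : ℕ) : ℤ) ∣ ((p ^ (e + j) : ℕ) : ℤ) ^ 2 := by
          norm_cast
          rw [← pow_mul]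
          exact pow_dvd_pow _ (by omega)
        have h6 : (1 : ℤ) + p * ((p ^ (e + j) : ℕ) * z) + ((p ^ (e + j) : ℕ) * z) ^ 2 * w - 1 =
            ((p ^ (e + j + 1) : ℕ) : ℤ) * z + ((p ^ (e + j) : ℕ) : ℤ) ^ 2 * (z ^ 2 * w) := by
          push_cast; ring
        rw [h6]
        exact dvd_add (dvd_mul_right _ _) (h5.mul_right _)
    refine (Nat.modEq_iff_dvd.2 ?_).symm
    exact_mod_cast this j
  rcases Nat.eq_zero_or_pos α with rfl | hα
  · simp [Nat.ModEq.refl]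
  obtain ⟨j, α', hα', rfl⟩ := Nat.exists_eq_pow_mul_and_not_dvd hα.ne' p hp.ne_one
  rw [pow_mul]
  suffices (t + 1) ^ p ^ j ≡ 1 [MOD p ^ n] by simpa using this.pow α'
  by_cases hjn : n ≤ j
  · exact (key 1 j le_rfl (by simpa using ht)).of_dvd (pow_dvd_pow _ (by omega))
  · have h2 : p ^ (n - j) ∣ t := by
      have h1 : p ^ j * p ^ (n - j) ∣ p ^ j * (α' * t) := by
        rw [← pow_add, Nat.add_sub_of_le (by omega), ← mul_assoc]; exact h
      have := Nat.dvd_of_mul_dvd_mul_left (pow_pos hp.pos j) h1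
      exact (Nat.Coprime.pow_left _ ((hp.coprime_iff_not_dvd).2 hα')).dvd_of_dvd_mul_left this
    have := key (n - j) j (by omega) h2
    rwa [Nat.sub_add_cancel (by omega)] at this

/-- Exact divisibility by p needs 4 ∣ r when p = 2: the sum is 2 + r. -/
theorem exists_geom_sum_eq {p : ℕ} (hp : p.Prime) {r : ℕ} (h : powerfulExponent p ∣ r) :
    ∃ m, p.Coprime m ∧ ∑ i ∈ Finset.range p, (r + 1) ^ i = p * m := by
  by_cases h2 : p = 2
  · subst h2
    obtain ⟨k, hk⟩ : 4 ∣ r := h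
    refine ⟨2 * k + 1, ?_, ?_⟩
    · rw [Nat.coprime_two_left, Nat.odd_iff]; omega
    · simp [Finset.sum_range_succ, hk]; ring
  · have hodd := hp.odd_of_ne_two h2
    obtain ⟨k, hk⟩ : p ∣ r := (dvd_powerfulExponent p).trans h
    have h1 := odd_sq_dvd_geom_sum₂_sub (R := ℤ) (a := 1) (b := k) hodd
    simp only [one_pow, mul_one] at h1
    obtain ⟨z, hz⟩ := h1
    have h3 : ((∑ i ∈ Finset.range p, (r + 1) ^ i : ℕ) : ℤ) = p * (1 + p * z) := by
      push_cast
      rw [hk]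
      have : (∑ i ∈ Finset.range p, (((p * k : ℕ) : ℤ) + 1) ^ i) =
          ∑ i ∈ Finset.range p, (1 + (p : ℤ) * k) ^ i := by
        refine Finset.sum_congr rfl fun i _ => ?_
        push_cast; ring
      rw [this]
      linear_combination hz
    have h4 : (p : ℤ) ∣ ((∑ i ∈ Finset.range p, (r + 1) ^ i : ℕ) : ℤ) := ⟨_, h3⟩
    obtain ⟨m, hm⟩ := Int.natCast_dvd_natCast.1 h4
    refine ⟨m, ?_, hm⟩
    rw [hp.coprime_iff_not_dvd]
    rintro ⟨l, rfl⟩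
    rw [hm] at h3
    push_cast at h3
    have h5 : ((p : ℤ) * l) = 1 + p * z := mul_left_cancel₀ (by exact_mod_cast hp.ne_zero) h3
    have h6 : (p : ℤ) ∣ 1 := ⟨l - z, by linear_combination -h5⟩
    have := Int.natCast_dvd_natCast.1 (by simpa using h6 : (p : ℤ) ∣ ((1 : ℕ) : ℤ))
    exact hp.one_lt.ne' (Nat.dvd_one.1 this)

theorem dvd_add_one_pow_sub_one {q t : ℕ} (h : q ∣ t) (α : ℕ) :
    ∃ r, q ∣ r ∧ (t + 1) ^ α = r + 1 := by
  induction α with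
  | zero => exact ⟨0, dvd_zero _, by simp⟩
  | succ α ih =>
    obtain ⟨r, hr, hr2⟩ := ih
    refine ⟨r * t + r + t, dvd_add (dvd_add (hr.mul_right _) hr) h, ?_⟩
    rw [pow_succ, hr2]; ring

end Arithmetic

namespace PowConj

variable {G : Type u} [Group G] {b y : G} {t : ℕ}

theorem pow (h : PowConj b t y) (m : ℕ) : PowConj b t (y ^ m) := by
  unfold PowConj at *
  have h1 : SemiconjBy b (y ^ (t + 1)) y := h.symm
  have := h1.pow_right m
  rw [← pow_mul, mul_comm, pow_mul]
  exact this.symm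

theorem mul_pow (h : PowConj b t y) (k : ℕ) : y * b ^ k = b ^ k * y ^ (t + 1) ^ k := by
  induction k with
  | zero => simp
  | succ k ih =>
    have h2 : y ^ (t + 1) ^ k * b = b * (y ^ (t + 1) ^ k) ^ (t + 1) := h.pow _
    rw [pow_succ, ← mul_assoc, ih, mul_assoc, h2, ← pow_mul, mul_assoc, pow_succ]

theorem pow_mul_pow (h : PowConj b t y) (j k : ℕ) :
    y ^ j * b ^ k = b ^ k * y ^ (j * (t + 1) ^ k) := by
  rw [(h.pow j).mul_pow k, ← pow_mul]

theorem mul_pow_geom (h : PowConj b t y) (α k : ℕ) : (b ^ α * y) ^ k =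
    b ^ (α * k) * y ^ ∑ i ∈ Finset.range k, ((t + 1) ^ α) ^ i := by
  induction k with
  | zero => simp
  | succ k ih =>
    rw [pow_succ, ih, geom_sum_succ]
    calc b ^ (α * k) * y ^ (∑ i ∈ Finset.range k, ((t + 1) ^ α) ^ i) * (b ^ α * y)
        = b ^ (α * k) * (y ^ (∑ i ∈ Finset.range k, ((t + 1) ^ α) ^ i) * b ^ α) * y := by
          simp only [mul_assoc]
      _ = _ := by
          rw [h.pow_mul_pow, mul_add α, pow_add b, mul_one, mul_comm ((t + 1) ^ α), pow_succ y]
          simp only [mul_assoc]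

theorem pow_mul_mul (h : PowConj b t y) {z : G} (α x β : ℕ) :
    ∃ j : ℕ, (b ^ α * y) ^ x * (b ^ β * z) = b ^ (α * x + β) * (y ^ j * z) := by
  refine ⟨(∑ i ∈ Finset.range x, ((t + 1) ^ α) ^ i) * (t + 1) ^ β, ?_⟩
  rw [h.mul_pow_geom]
  calc b ^ (α * x) * y ^ (∑ i ∈ Finset.range x, ((t + 1) ^ α) ^ i) * (b ^ β * z)
      = b ^ (α * x) * (y ^ (∑ i ∈ Finset.range x, ((t + 1) ^ α) ^ i) * b ^ β) * z := by
        simp only [mul_assoc]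
    _ = _ := by
        rw [h.pow_mul_pow, pow_add b]
        simp only [mul_assoc]

/-- A power of `b` which is raised to the power `t + 1` by `b` commutes with every such element. -/
theorem commute_of_eq_inv_pow {p n : ℕ} (hp : p.Prime) (hb : orderOf b = p ^ n) (ht : p ∣ t)
    (hexp : ∀ g : G, g ^ p ^ n = 1) {α : ℕ} {z : G} (hy : PowConj b t y) (hz : PowConj b t z)
    (h : b ^ α * y = 1) : Commute y z := by
  have hyb : y = (b ^ α)⁻¹ := eq_inv_of_mul_eq_one_right h
  have h1 : Commute y b := by rw [hyb]; exact (Commute.pow_self b α).inv_left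
  have h2 : y ^ t = 1 := by
    unfold PowConj at hy
    rw [h1.eq, mul_right_inj, pow_succ'] at hy
    exact mul_eq_left.1 hy.symm
  have h3 : p ^ n ∣ α * t := by
    rw [← hb, orderOf_dvd_iff_pow_eq_one, pow_mul]
    rw [hyb, inv_pow, inv_eq_one] at h2
    exact h2
  have h4 := pow_dvd_add_one_pow_sub_one ht h3 hp
  have h5 : z ^ (t + 1) ^ α = z := by
    rw [pow_eq_pow_of_modEq h4 (hexp z), pow_one]
  have h6 := hz.mul_pow α
  rw [h5] at h6
  rw [hyb]
  exact (Commute.inv_left h6.symm)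

/-- If `z` commutes with the second factor of every decomposition `b ^ α' * y'` of
`(b ^ α * y) ^ p`, then it commutes with `y ^ p`. -/
theorem commute_pow_prime {p : ℕ} (hp : p.Prime) (hG : IsPGroup p G)
    (ht : powerfulExponent p ∣ t) {α : ℕ} (hy : PowConj b t y) {z : G}
    (h : ∀ α' y', PowConj b t y' → (b ^ α * y) ^ p = b ^ α' * y' → Commute y' z) :
    Commute (y ^ p) z := by
  obtain ⟨r, hr, hr2⟩ := dvd_add_one_pow_sub_one ht α
  obtain ⟨m, hm, hm2⟩ := exists_geom_sum_eq hp hr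
  have h1 := hy.mul_pow_geom α p
  rw [hr2, hm2] at h1
  have h2 := h _ _ (hy.pow _) h1
  have := Fact.mk hp
  have h3 : m.Coprime (orderOf (y ^ p)) := by
    obtain ⟨k, hk⟩ := IsPGroup.iff_orderOf.1 hG (y ^ p)
    rw [hk]
    exact (hm.symm).pow_right k
  obtain ⟨m', hm'⟩ := exists_pow_eq_self_of_coprime h3
  rw [← hm', ← pow_mul y]
  exact h2.pow_left m'

section ClassTwo

variable {y₁ y₂ c : G} {p : ℕ}

/-- This closure under products is available before y₁ and y₂ are known to commute: p divides the
binomial coefficient of t + 1 over 2, so the (t+1)-st power is multiplicative here. -/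
theorem pow_mul_of_commutator (hp : p.Prime) (ht : powerfulExponent p ∣ t) (h1 : PowConj b t y₁)
    (h2 : PowConj b t y₂) (hc : y₂ * y₁ = y₁ * y₂ * c) (hc1 : Commute c y₁) (hc2 : Commute c y₂)
    (hcp : c ^ p = 1) (j : ℕ) : PowConj b t (y₁ ^ j * y₂) := by
  have h3 : (y₁ ^ j * y₂) ^ (t + 1) = (y₁ ^ j) ^ (t + 1) * y₂ ^ (t + 1) :=
    mul_pow_of_commutator_pow_eq_one (mul_pow_eq_of_commute_commutator hc hc1 j)
      ((hc1.pow_right j).pow_left j) (hc2.pow_left j)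
      (by rw [← pow_mul, mul_comm, pow_mul, hcp, one_pow])
      (dvd_choose_two hp (Or.inr (by simpa using ht)))
  have h4 : y₁ ^ j * b = b * (y₁ ^ j) ^ (t + 1) := h1.pow j
  unfold PowConj at h2 ⊢
  rw [h3, mul_assoc, h2, ← mul_assoc, h4, mul_assoc]

/-- Multiplying the second generator by a power of the first removes its b-part and leaves s = y₁^x
y₂ in the subgroup. Moving s past b^α y₁ raises s to a power and produces exactly c. -/
theorem commutator_mem_closure_aux [Finite G] (hp : p.Prime) (ht : powerfulExponent p ∣ t)
    (h1 : PowConj b t y₁)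
    (h2 : PowConj b t y₂) (hc : y₂ * y₁ = y₁ * y₂ * c) (hc1 : Commute c y₁) (hc2 : Commute c y₂)
    (hcp : c ^ p = 1) (α β : ℕ)
    (h : b ^ β ∈ Subgroup.zpowers (b ^ α)) :
    c ∈ Subgroup.closure {b ^ α * y₁, b ^ β * y₂} := by
  have hpt := (dvd_powerfulExponent p).trans ht
  obtain ⟨k, hk⟩ := (mem_powers_iff_mem_zpowers).2 h
  simp only at hk
  set H := Subgroup.closure {b ^ α * y₁, b ^ β * y₂} with hH
  have hu : b ^ α * y₁ ∈ H := Subgroup.subset_closure (by simp)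
  have hv : b ^ β * y₂ ∈ H := Subgroup.subset_closure (by simp)
  obtain ⟨x, hx⟩ : ∃ x : ℕ, ((b ^ α * y₁) ^ k)⁻¹ * (b ^ β * y₂) = y₁ ^ x * y₂ := by
    rw [h1.mul_pow_geom, pow_mul, hk]
    obtain ⟨x, hx⟩ := exists_npow_eq_zpow y₁ (-(∑ i ∈ Finset.range k, ((t + 1) ^ α) ^ i : ℕ))
    refine ⟨x, ?_⟩
    rw [hx, zpow_neg, zpow_natCast]
    group
  set s := y₁ ^ x * y₂ with hs
  have hsH : s ∈ H := by rw [← hx]; exact H.mul_mem (H.inv_mem (H.pow_mem hu k)) hv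
  have hsP : PowConj b t s := h1.pow_mul_of_commutator hp ht h2 hc hc1 hc2 hcp x
  have hsc : Commute c s := (hc1.pow_right x).mul_right hc2
  have hs1 : s * y₁ = y₁ * s * c := by
    rw [hs, mul_assoc, hc]
    simp only [← mul_assoc]
    rw [← pow_succ, ← pow_succ']
  have hcT : c ^ (t + 1) ^ α = c := by
    obtain ⟨r, hr, hr2⟩ := dvd_add_one_pow_sub_one hpt α
    obtain ⟨l, rfl⟩ := hr
    rw [hr2, pow_succ, pow_mul, hcp, one_pow, one_mul]
  have h3 : s * (b ^ α * y₁) = b ^ α * y₁ * s ^ (t + 1) ^ α * c := by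
    have h4 := pow_mul_eq_of_commute_commutator hs1 hsc ((t + 1) ^ α)
    rw [hcT] at h4
    rw [← mul_assoc, hsP.mul_pow, mul_assoc, h4]
    simp only [mul_assoc]
  rw [← inv_mul_eq_iff_eq_mul] at h3
  rw [← h3]
  exact H.mul_mem (H.inv_mem (H.mul_mem hu (H.pow_mem hsH _))) (H.mul_mem hsH hu)

theorem pow_mem_zpowers_pow_or {n : ℕ} (hp : p.Prime) (hb : orderOf b = p ^ n) (α β : ℕ) :
    b ^ β ∈ Subgroup.zpowers (b ^ α) ∨ b ^ α ∈ Subgroup.zpowers (b ^ β) := by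
  have key : ∀ α β : ℕ, α.gcd (p ^ n) ∣ β → b ^ β ∈ Subgroup.zpowers (b ^ α) := by
    rintro α β ⟨m, rfl⟩
    refine ⟨α.gcdA (p ^ n) * m, ?_⟩
    have h := Nat.gcd_eq_gcd_ab α (p ^ n)
    simp only
    rw [← zpow_natCast, ← zpow_natCast, ← zpow_mul]
    push_cast
    rw [h, add_mul, zpow_add, mul_assoc ((p ^ n : ℕ) : ℤ), zpow_mul b ((p ^ n : ℕ) : ℤ), zpow_natCast b (p ^ n), ← hb,
      pow_orderOf_eq_one, one_zpow, mul_one, mul_assoc]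
  obtain ⟨i, -, hi⟩ := (Nat.dvd_prime_pow hp).1 (Nat.gcd_dvd_right α (p ^ n))
  obtain ⟨j, -, hj⟩ := (Nat.dvd_prime_pow hp).1 (Nat.gcd_dvd_right β (p ^ n))
  rcases le_total i j with h | h
  · left
    apply key
    rw [hi]
    exact (pow_dvd_pow p h).trans (hj ▸ Nat.gcd_dvd_left β (p ^ n))
  · right
    apply key
    rw [hj]
    exact (pow_dvd_pow p h).trans (hi ▸ Nat.gcd_dvd_left α (p ^ n))

theorem commutator_mem_closure [Finite G] {n : ℕ} (hp : p.Prime) (hb : orderOf b = p ^ n)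
    (ht : powerfulExponent p ∣ t) (h1 : PowConj b t y₁)
    (h2 : PowConj b t y₂) (hc : y₂ * y₁ = y₁ * y₂ * c) (hc1 : Commute c y₁) (hc2 : Commute c y₂)
    (hcp : c ^ p = 1) (α β : ℕ) :
    c ∈ Subgroup.closure {b ^ α * y₁, b ^ β * y₂} := by
  rcases pow_mem_zpowers_pow_or hp hb α β with h | h
  · exact commutator_mem_closure_aux hp ht h1 h2 hc hc1 hc2 hcp α β h
  · have hc' : y₁ * y₂ = y₂ * y₁ * c⁻¹ := by rw [hc, mul_inv_cancel_right]
    have := commutator_mem_closure_aux hp ht h2 h1 hc' hc2.inv_left hc1.inv_left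
      (by rw [inv_pow, hcp, inv_one]) β α h
    rw [Set.pair_comm, ← inv_inv c]
    exact Subgroup.inv_mem _ this

end ClassTwo

end PowConj

/-! ### Elements with the same power action commute -/

namespace IsFinHerPowerful

variable {p : ℕ} {G : Type u} [Group G]

theorem orderOf_lt_of_pow_eq_one {u u' : G} {k : ℕ} (hp : p.Prime) (hu : orderOf u = p ^ (k + 1))
    (h : u' ^ p ^ k = 1) : orderOf u' < orderOf u := by
  rw [hu]
  exact (Nat.le_of_dvd (pow_pos hp.pos k) (orderOf_dvd_of_pow_eq_one h)).trans_lt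
    (Nat.pow_lt_pow_right hp.one_lt (Nat.lt_succ_self k))

/-- In a minimal counterexample the commutator c of y₁ and y₂ has order p and commutes with both.
Minimality makes the socles of b, u = b^α y₁ and v = b^β y₂ independent, since otherwise a translate
has smaller order. But c lies in ⟨b^α' y₁, b^β' y₂⟩ for all α' and β'; comparing its socle
coordinates for three such choices forces c = 1. -/
theorem powConj_commute_step (hG : IsFinHerPowerful p G) {n : ℕ}
    (hexp : ∀ g : G, g ^ p ^ (n + 1) = 1) {b : G} (hb : orderOf b = p ^ (n + 1)) {t : ℕ}
    (ht : powerfulExponent p ∣ t) {α β : ℕ} {y₁ y₂ : G} (h1 : PowConj b t y₁)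
    (h2 : PowConj b t y₂)
    (ih : ∀ (α' β' : ℕ) (z₁ z₂ : G), PowConj b t z₁ → PowConj b t z₂ →
      orderOf (b ^ α' * z₁) * orderOf (b ^ β' * z₂) <
        orderOf (b ^ α * y₁) * orderOf (b ^ β * y₂) → Commute z₁ z₂)
    (hle : orderOf (b ^ β * y₂) ≤ orderOf (b ^ α * y₁)) : Commute y₁ y₂ := by
  have hp := hG.prime
  have := hG.finite
  have hpt := (dvd_powerfulExponent p).trans ht
  by_cases hu1 : b ^ α * y₁ = 1
  · exact h1.commute_of_eq_inv_pow hp hb hpt hexp h2 hu1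
  by_cases hv1 : b ^ β * y₂ = 1
  · exact (h2.commute_of_eq_inv_pow hp hb hpt hexp h1 hv1).symm
  by_contra hncomm
  obtain ⟨k, hk⟩ := hG.exists_orderOf hu1
  obtain ⟨m, hm⟩ := hG.exists_orderOf hv1
  have hupos := orderOf_pos (b ^ α * y₁)
  have hvpos := orderOf_pos (b ^ β * y₂)
  have ih1 : ∀ (α' : ℕ) (z₁ : G), PowConj b t z₁ → (b ^ α' * z₁) ^ p ^ k = 1 →
      Commute z₁ y₂ := fun α' z₁ hz h =>
    ih α' β z₁ y₂ hz h2 (Nat.mul_lt_mul_of_pos_right (orderOf_lt_of_pow_eq_one hp hk h) hvpos)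
  have ih2 : ∀ (β' : ℕ) (z₂ : G), PowConj b t z₂ → (b ^ β' * z₂) ^ p ^ m = 1 →
      Commute y₁ z₂ := fun β' z₂ hz h =>
    ih α β' y₁ z₂ h1 hz (Nat.mul_lt_mul_of_pos_left (orderOf_lt_of_pow_eq_one hp hm h) hupos)
  -- The p-th power of u has smaller order and y-part y₁^(pm) with m prime to p, so minimality
  -- applies to it.
  have hp1 : Commute (y₁ ^ p) y₂ := by
    refine h1.commute_pow_prime hp hG.isPGroup ht (α := α) fun α' y' hy' h => ih1 α' y' hy' ?_
    rw [← h, ← pow_mul, ← pow_succ', ← hk, pow_orderOf_eq_one]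
  have hp2 : Commute (y₂ ^ p) y₁ := by
    refine h2.commute_pow_prime hp hG.isPGroup ht (α := β) fun α' y' hy' h =>
      (ih2 α' y' hy' ?_).symm
    rw [← h, ← pow_mul, ← pow_succ', ← hm, pow_orderOf_eq_one]
  obtain ⟨c, hc⟩ : ∃ c, y₂ * y₁ = y₁ * y₂ * c := ⟨_, (mul_inv_cancel_left _ _).symm⟩
  obtain ⟨hc1, hc2, hcp⟩ := hG.commute_commutator_of_pow_commute hc hp1 hp2
  have hcne : c ≠ 1 := by
    rintro rfl
    rw [mul_one] at hc
    exact hncomm hc.symm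
  have hmem := h1.commutator_mem_closure hp hb ht h2 hc hc1 hc2 hcp
  have hmk : m ≤ k := by
    rw [hk, hm, Nat.pow_le_pow_iff_right hp.one_lt] at hle
    omega
  have hkn : k ≤ n := by
    have := orderOf_dvd_of_pow_eq_one (hexp (b ^ α * y₁))
    rw [hk, Nat.pow_dvd_pow_iff_le_right hp.one_lt] at this
    omega
  set u := b ^ α * y₁ with hu
  set v := b ^ β * y₂ with hv
  set w := b ^ p ^ n with hw
  have hwc : ∀ g, Commute w g := fun g => hG.pow_commute hexp b g
  have hup : (u ^ p ^ k) ^ p = 1 := by rw [← pow_mul, ← pow_succ, ← hk, pow_orderOf_eq_one]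
  have hvp : (v ^ p ^ m) ^ p = 1 := by rw [← pow_mul, ← pow_succ, ← hm, pow_orderOf_eq_one]
  have hwp : w ^ p = 1 := by rw [← pow_mul, ← pow_succ, ← hb, pow_orderOf_eq_one]
  have huv : Commute (u ^ p ^ k) (v ^ p ^ m) := hG.commute_of_pow_prime hup hvp
  have hbz : ∀ r ≤ n, (b ^ p ^ (n - r)) ^ p ^ r = w := by
    intro r hr
    rw [← pow_mul, ← pow_add, Nat.sub_add_cancel hr]
  -- the socles of `u`, `v` and `b` are independent
  have hμ : u ^ p ^ k ∉ Subgroup.zpowers w := by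
    intro h
    obtain ⟨l, hl⟩ := (mem_powers_iff_mem_zpowers).2 (inv_mem h)
    simp only at hl
    apply hncomm
    apply ih1 (p ^ (n - k) * l + α) y₁ h1
    rw [pow_add, mul_assoc, mul_pow_prime_pow k hG]
    · rw [pow_mul, pow_right_comm, hbz k hkn, hl, inv_mul_cancel]
    · rw [pow_mul, pow_right_comm, pow_succ, pow_mul, hbz k hkn, hwp, one_pow]
    · rw [← hk, pow_orderOf_eq_one]
  have hν : v ^ p ^ m ∉ Subgroup.closure {w, u ^ p ^ k} := by
    intro h
    obtain ⟨l', i', hli⟩ := hG.exists_zpow_mul_zpow (inv_mem h)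
    obtain ⟨l, hl⟩ := exists_npow_eq_zpow w l'
    obtain ⟨i, hi⟩ := exists_npow_eq_zpow (u ^ p ^ k) i'
    rw [← hl, ← hi] at hli
    obtain ⟨j, hj⟩ := h1.pow_mul_mul (z := y₂) α (p ^ (k - m) * i) β
    have h3 := h1.pow_mul_of_commutator hp ht h2 hc hc1 hc2 hcp j
    -- If the socle of v were a product of powers of the other two, then multiplying v by suitable
    -- powers of b and u would give an element killed by p^m. Its y-part is y₁^j y₂, which commutes
    -- with y₁ exactly when y₂ does.
    have h4 : Commute y₁ (y₁ ^ j * y₂) := by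
      apply ih2 (p ^ (n - m) * l + (α * (p ^ (k - m) * i) + β)) _ h3
      have e1 : (u ^ (p ^ (k - m) * i)) ^ p ^ m = (u ^ p ^ k) ^ i := by
        rw [← pow_mul, ← pow_mul, mul_right_comm, ← pow_add, Nat.sub_add_cancel hmk]
      have e2 : (b ^ (p ^ (n - m) * l)) ^ p ^ m = w ^ l := by
        rw [pow_mul, pow_right_comm, hbz m (hmk.trans hkn)]
      have e3 : v ^ p ^ (m + 1) = 1 := by rw [← hm, pow_orderOf_eq_one]
      have e4 : (u ^ (p ^ (k - m) * i)) ^ p ^ (m + 1) = 1 := by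
        rw [pow_succ, pow_mul, e1, pow_right_comm, hup, one_pow]
      have e5 : (b ^ (p ^ (n - m) * l)) ^ p ^ (m + 1) = 1 := by
        rw [pow_succ, pow_mul, e2, pow_right_comm, hwp, one_pow]
      rw [pow_add, mul_assoc, ← hj, mul_pow_prime_pow m hG e5 (mul_pow_eq_one _ hG e4 e3),
        mul_pow_prime_pow m hG e4 e3, e1, e2, ← mul_assoc, ← hli, inv_mul_cancel]
    have h5 := ((Commute.refl y₁).pow_right j).inv_right.mul_right h4
    rw [inv_mul_cancel_left] at h5
    exact hncomm h5
  have hwK : w ∈ Subgroup.closure {w, u ^ p ^ k} := Subgroup.subset_closure (by simp)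
  have huK : u ^ p ^ k ∈ Subgroup.closure {w, u ^ p ^ k} := Subgroup.subset_closure (by simp)
  set K := Subgroup.closure {w, u ^ p ^ k} with hK
  have hwne : ∀ i : ℤ, w ^ i = 1 → ∀ g : G, g ^ p = 1 → g ^ i = 1 := by
    intro i hi g hg
    have hwo : orderOf w = p := by
      rw [hw, orderOf_pow_of_dvd (pow_ne_zero _ hp.ne_zero) (hb ▸ pow_dvd_pow p (Nat.le_succ n)),
        hb, pow_succ, Nat.mul_div_cancel_left _ (pow_pos hp.pos n)]
    rw [← orderOf_dvd_iff_zpow_eq_one, hwo] at hi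
    obtain ⟨d, rfl⟩ := hi
    rw [zpow_mul, zpow_natCast, hg, one_zpow]
  have hordu : orderOf (b ^ p ^ (n - k) * u) = p ^ (k + 1) ∧
      (b ^ p ^ (n - k) * u) ^ p ^ k = w * u ^ p ^ k := by
    have e1 : (b ^ p ^ (n - k)) ^ p ^ (k + 1) = 1 := by
      rw [pow_succ, pow_mul, hbz k hkn, hwp]
    have e2 : u ^ p ^ (k + 1) = 1 := by rw [← hk, pow_orderOf_eq_one]
    have e3 : (b ^ p ^ (n - k) * u) ^ p ^ k = w * u ^ p ^ k := by
      rw [mul_pow_prime_pow k hG e1 e2, hbz k hkn]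
    refine ⟨?_, e3⟩
    have := Fact.mk hp
    refine orderOf_eq_prime_pow ?_ (mul_pow_eq_one _ hG e1 e2)
    rw [e3]
    intro h
    apply hμ
    rw [eq_inv_of_mul_eq_one_right h]
    exact inv_mem (Subgroup.mem_zpowers w)
  have hordv : orderOf (b ^ p ^ (n - m) * v) = p ^ (m + 1) ∧
      (b ^ p ^ (n - m) * v) ^ p ^ m = w * v ^ p ^ m := by
    have e1 : (b ^ p ^ (n - m)) ^ p ^ (m + 1) = 1 := by
      rw [pow_succ, pow_mul, hbz m (hmk.trans hkn), hwp]
    have e2 : v ^ p ^ (m + 1) = 1 := by rw [← hm, pow_orderOf_eq_one]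
    have e3 : (b ^ p ^ (n - m) * v) ^ p ^ m = w * v ^ p ^ m := by
      rw [mul_pow_prime_pow m hG e1 e2, hbz m (hmk.trans hkn)]
    refine ⟨?_, e3⟩
    have := Fact.mk hp
    refine orderOf_eq_prime_pow ?_ (mul_pow_eq_one _ hG e1 e2)
    rw [e3]
    intro h
    apply hν
    rw [eq_inv_of_mul_eq_one_right h]
    exact inv_mem hwK
  have hzu : ∀ g ∈ K, Subgroup.zpowers g ≤ K := fun g hg => (Subgroup.zpowers_le).2 hg
  -- With μ and ν the socle generators of u and v, this and the next two steps give c = μ^i ν^j =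
  -- (wμ)^i' ν^j' = μ^i'' (wν)^j''. Independence of w, μ, ν makes the first two expressions kill the
  -- μ-part and the last one the ν-part.
  obtain ⟨i, j, hij⟩ := hG.exists_socle_of_mem_closure hk hm (fun h => hν (hzu _ huK h))
    (hmem α β) hcp
  obtain ⟨i', j', hij'⟩ := hG.exists_socle_of_mem_closure hordu.1 hm
    (fun h => hν (hzu _ (by rw [hordu.2]; exact K.mul_mem hwK huK) h))
    (by have := hmem (p ^ (n - k) + α) β; rwa [pow_add, mul_assoc] at this) hcp
  obtain ⟨i'', j'', hij''⟩ := hG.exists_socle_of_mem_closure hk hordv.1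
    (fun h => hν (by
      have := hzu _ huK h
      rw [hordv.2] at this
      exact (K.mul_mem_cancel_left hwK).1 this))
    (by have := hmem α (p ^ (n - m) + β); rwa [pow_add b, mul_assoc] at this) hcp
  rw [hordu.2, (hwc _).mul_zpow] at hij'
  rw [hordv.2, (hwc _).mul_zpow] at hij''
  set μ := u ^ p ^ k
  set ν := v ^ p ^ m
  have s1 : ν ^ (j - j') = μ ^ (-i) * (w ^ i' * μ ^ i') := by
    have : μ ^ i * ν ^ j = w ^ i' * μ ^ i' * ν ^ j' := by rw [← hij, ← hij']
    rw [zpow_sub, zpow_neg, eq_inv_mul_iff_mul_eq, ← mul_assoc, this, mul_inv_cancel_right]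
  have s2 : ν ^ (j - j') = 1 := zpow_eq_one_of_mem hp hvp hν (by
    rw [s1]
    exact K.mul_mem (K.zpow_mem huK _) (K.mul_mem (K.zpow_mem hwK _) (K.zpow_mem huK _)))
  rw [s2] at s1
  have s3 : μ ^ (i - i') = w ^ i' := by
    rw [((hwc (μ ^ i')).zpow_left i').eq, ← mul_assoc, ← zpow_add] at s1
    rw [eq_inv_of_mul_eq_one_right s1.symm, ← zpow_neg]
    congr 1; ring
  have s4 : μ ^ (i - i') = 1 := zpow_eq_one_of_mem hp hup hμ ⟨i', s3.symm⟩
  have s5 : μ ^ i' = 1 := hwne i' (by rw [← s3, s4]) μ hup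
  have s6 : μ ^ i = 1 := by rw [← sub_add_cancel i i', zpow_add, s4, s5, one_mul]
  rw [s6, one_mul] at hij
  have t1 : ν ^ (j - j'') = μ ^ i'' * w ^ j'' := by
    rw [zpow_sub, ← hij, hij'', ← mul_assoc, mul_inv_cancel_right]
  have t2 : ν ^ (j - j'') = 1 := zpow_eq_one_of_mem hp hvp hν (by
    rw [t1]
    exact K.mul_mem (K.zpow_mem huK _) (K.zpow_mem hwK _))
  rw [t2] at t1
  have t3 : μ ^ i'' = 1 := zpow_eq_one_of_mem hp hup hμ (by
    rw [eq_inv_of_mul_eq_one_left t1.symm]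
    exact inv_mem ⟨j'', rfl⟩)
  rw [t3, one_mul] at t1
  have t4 : ν ^ j'' = 1 := hwne j'' t1.symm ν hvp
  apply hcne
  rw [hij, ← sub_add_cancel j j'', zpow_add, t2, t4, one_mul]

/-- Let `b` have order equal to the exponent of the group. The elements which `b` conjugates to
their `(t + 1)`-st power commute with each other. -/
theorem powConj_commute (hG : IsFinHerPowerful p G) {n : ℕ}
    (hexp : ∀ g : G, g ^ p ^ (n + 1) = 1) {b : G} (hb : orderOf b = p ^ (n + 1)) {t : ℕ}
    (ht : powerfulExponent p ∣ t) {y₁ y₂ : G} (h1 : PowConj b t y₁)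
    (h2 : PowConj b t y₂) : Commute y₁ y₂ := by
  have key : ∀ N : ℕ, ∀ (α β : ℕ) (y₁ y₂ : G), PowConj b t y₁ → PowConj b t y₂ →
      orderOf (b ^ α * y₁) * orderOf (b ^ β * y₂) = N → Commute y₁ y₂ := by
    intro N
    induction N using Nat.strong_induction_on with
    | _ N ih =>
      intro α β y₁ y₂ h1 h2 hN
      subst hN
      rcases le_total (orderOf (b ^ β * y₂)) (orderOf (b ^ α * y₁)) with h | h
      · exact hG.powConj_commute_step hexp hb ht h1 h2
          (fun α' β' z₁ z₂ hz₁ hz₂ hlt => ih _ hlt α' β' z₁ z₂ hz₁ hz₂ rfl) h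
      · refine (hG.powConj_commute_step hexp hb ht h2 h1
          (fun α' β' z₁ z₂ hz₁ hz₂ hlt => ih _ ?_ α' β' z₁ z₂ hz₁ hz₂ rfl) h).symm
        rwa [mul_comm (orderOf (b ^ α * y₁))]
  exact key _ 0 0 y₁ y₂ h1 h2 rfl

end IsFinHerPowerful

/-! ### Lifting power triples through a central quotient -/

section Auxiliary

theorem exists_powerfulExponent_eq_pow (p : ℕ) : ∃ e, powerfulExponent p = p ^ e := by
  unfold powerfulExponent
  split_ifs with h
  · exact ⟨2, by subst h; rfl⟩
  · exact ⟨1, (pow_one p).symm⟩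

variable {G : Type u} [Group G]

theorem zpow_eq_one_of_zpow_eq_one {p : ℕ} (hp : p.Prime) {w g : G} (hw : w ^ p = 1) (hw1 : w ≠ 1)
    (hg : g ^ p = 1) {i : ℤ} (hi : w ^ i = 1) : g ^ i = 1 := by
  have := Fact.mk hp
  rw [← orderOf_dvd_iff_zpow_eq_one, orderOf_eq_prime hw hw1] at hi
  obtain ⟨d, rfl⟩ := hi
  rw [zpow_mul, zpow_natCast, hg, one_zpow]

theorem mem_of_zpow_mem_of_ne_one {p : ℕ} (hp : p.Prime) {w : G} (hw : w ^ p = 1) {H : Subgroup G}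
    {i : ℤ} (hi : w ^ i ∈ H) (h1 : w ^ i ≠ 1) : w ∈ H := by
  by_contra h
  exact h1 (zpow_eq_one_of_mem hp hw h hi)

theorem PowConj.of_mul_left {p t : ℕ} (hp : p.Prime) (ht : powerfulExponent p ∣ t) {b x y c : G}
    (hxy : PowConj b t (x * y)) (hy : PowConj b t y) (hc : y * x = x * y * c) (hcx : Commute c x)
    (hcy : Commute c y) (hcp : c ^ p = 1) : PowConj b t x := by
  have h := mul_pow_of_commutator_pow_eq_one hc hcx hcy hcp
    (dvd_choose_two hp (Or.inr (by simpa using ht)) : p ∣ (t + 1).choose 2)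
  unfold PowConj at *
  rw [h, mul_assoc, hy, ← mul_assoc, ← mul_assoc] at hxy
  exact mul_right_cancel hxy

theorem PowConj.of_mul_right {p t : ℕ} (hp : p.Prime) (ht : powerfulExponent p ∣ t) {b x y c : G}
    (hxy : PowConj b t (x * y)) (hx : PowConj b t x) (hc : y * x = x * y * c) (hcx : Commute c x)
    (hcy : Commute c y) (hcp : c ^ p = 1) : PowConj b t y := by
  have h := mul_pow_of_commutator_pow_eq_one hc hcx hcy hcp
    (dvd_choose_two hp (Or.inr (by simpa using ht)) : p ∣ (t + 1).choose 2)
  unfold PowConj at *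
  rw [h, ← mul_assoc, ← hx, mul_assoc, mul_assoc] at hxy
  exact mul_left_cancel hxy

end Auxiliary

/-- `G = ⟨b⟩ A` with `A` abelian normal and `b` acting on `A` as the `(t + 1)`-st power map, where
`powerfulExponent p ∣ t` and the order of `b` is the exponent of `G`. -/
def HasPowerTriple (p : ℕ) (G : Type u) [Group G] : Prop :=
  ∃ (A : Subgroup G) (b : G) (t : ℕ), powerfulExponent p ∣ t ∧ A.Normal ∧
    (∀ x ∈ A, ∀ y ∈ A, Commute x y) ∧ (∀ g, ∃ i : ℤ, ∃ a ∈ A, g = b ^ i * a) ∧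
    (∀ a ∈ A, PowConj b t a) ∧ ∀ g : G, g ^ orderOf b = 1

namespace IsFinHerPowerful

variable {p : ℕ} {G : Type u} [Group G]

/-- Because the elements satisfying `PowConj b t` commute, they already form a subgroup, which
serves as A; it is normalized by b and by itself. -/
theorem hasPowerTriple_of_closure (hG : IsFinHerPowerful p G) {n : ℕ}
    (hexp : ∀ g : G, g ^ p ^ (n + 1) = 1) {b : G} (hb : orderOf b = p ^ (n + 1)) {t : ℕ}
    (ht : powerfulExponent p ∣ t)
    (hgen : ∀ g, ∃ i : ℤ, ∃ s ∈ Subgroup.closure {y | PowConj b t y}, g = b ^ i * s) :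
    HasPowerTriple p G := by
  have hcomm : ∀ {x y : G}, PowConj b t x → PowConj b t y → Commute x y :=
    fun h1 h2 => hG.powConj_commute hexp hb ht h1 h2
  let A : Subgroup G :=
    { carrier := {y | PowConj b t y}
      one_mem' := by simp [PowConj]
      mul_mem' := by
        intro x y hx hy
        have h := hcomm hx hy
        change PowConj b t x at hx
        change PowConj b t y at hy
        change PowConj b t (x * y)
        unfold PowConj at *
        rw [h.mul_pow, mul_assoc, hy, ← mul_assoc, hx, mul_assoc]
      inv_mem' := by
        intro x hx
        change PowConj b t x at hx
        change PowConj b t x⁻¹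
        unfold PowConj at *
        rw [inv_pow, inv_mul_eq_iff_eq_mul, ← mul_assoc, hx, mul_inv_cancel_right] }
  have hA : Subgroup.closure {y | PowConj b t y} ≤ A := (Subgroup.closure_le _).2 fun y hy => hy
  have hgen' : ∀ g, ∃ i : ℤ, ∃ a ∈ A, g = b ^ i * a := fun g => by
    obtain ⟨i, s, hs, h⟩ := hgen g
    exact ⟨i, s, hA hs, h⟩
  refine ⟨A, b, t, ht, ⟨fun y hy g => ?_⟩, fun x hx y hy => hcomm hx hy, hgen', fun a ha => ha,
    fun g => by rw [hb, hexp]⟩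
  obtain ⟨i, a, ha, rfl⟩ := hgen' g
  have h1 : Commute a y := hcomm ha hy
  have h2 : b ^ i * a * y * (b ^ i * a)⁻¹ = b ^ i * y * (b ^ i)⁻¹ := by
    rw [mul_assoc (b ^ i), h1.eq]; group
  rw [h2]
  change PowConj b t y at hy
  change PowConj b t (b ^ i * y * (b ^ i)⁻¹)
  unfold PowConj at *
  rw [conj_pow]
  calc b ^ i * y * (b ^ i)⁻¹ * b = b ^ i * (y * b) * (b ^ i)⁻¹ := by group
    _ = b * (b ^ i * y ^ (t + 1) * (b ^ i)⁻¹) := by rw [hy]; group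

/-- The error w^l is absorbed by choosing i with (b^i)^t = w^l, possible because p^(n+1) does not
divide t. Then (t+1)^i is 1 modulo p^n, so b^i and y commute up to a central element killed by p,
and (b^i y)^t = w^l y^t. -/
theorem exists_powConj_pow_mul (hG : IsFinHerPowerful p G) {n : ℕ}
    (hexp : ∀ g : G, g ^ p ^ (n + 1) = 1) {b : G} {t : ℕ}
    (ht : powerfulExponent p ∣ t) (htn : ¬ p ^ (n + 1) ∣ t) {y : G} {l : ℕ}
    (hy : y * b = b * y ^ (t + 1) * (b ^ p ^ n) ^ l) : ∃ i : ℕ, PowConj b t (b ^ i * y) := by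
  have hp := hG.prime
  have hpt := (dvd_powerfulExponent p).trans ht
  set w := b ^ p ^ n with hw
  have hwc : ∀ g, Commute w g := fun g => hG.pow_commute hexp b g
  have hpp : ∀ g : G, (g ^ p ^ n) ^ p = 1 := fun g => by rw [← pow_mul, ← pow_succ, hexp]
  have ht0 : t ≠ 0 := by rintro rfl; exact htn (dvd_zero _)
  obtain ⟨s, t', ht', rfl⟩ := Nat.exists_eq_pow_mul_and_not_dvd ht0 p hp.ne_one
  have hsn : s ≤ n := by
    by_contra h
    exact htn ((pow_dvd_pow p (by omega)).mul_right t')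
  set t := p ^ s * t' with htdef
  obtain ⟨j, hj⟩ : ∃ j : ℕ, w ^ (j * t') = w ^ l := by
    have := Fact.mk hp
    have h1 : (t').Coprime (orderOf w) := by
      have : orderOf w ∣ p := orderOf_dvd_of_pow_eq_one (hpp b)
      exact Nat.Coprime.coprime_dvd_right this ((hp.coprime_iff_not_dvd).2 ht').symm
    obtain ⟨m, hm⟩ := exists_pow_eq_self_of_coprime h1
    refine ⟨m * l, ?_⟩
    rw [show m * l * t' = t' * m * l by ring, pow_mul, pow_mul, hm]
  have hyk : ∀ k : ℕ, ∃ l' : ℕ, y * b ^ k = b ^ k * y ^ (t + 1) ^ k * w ^ l' := by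
    intro k
    induction k with
    | zero => exact ⟨0, by simp⟩
    | succ k ih =>
      obtain ⟨l', hl'⟩ := ih
      refine ⟨l * (t + 1) ^ k + l', ?_⟩
      have h1 : y ^ (t + 1) ^ k * b = b * (y ^ (t + 1) ^ (k + 1) * w ^ (l * (t + 1) ^ k)) := by
        have h2 : SemiconjBy b (y ^ (t + 1) * w ^ l) y := by
          rw [SemiconjBy, hy, mul_assoc]
        have h3 := h2.pow_right ((t + 1) ^ k)
        rw [(((hwc (y ^ (t + 1))).pow_left l).symm).mul_pow, ← pow_mul, ← pow_mul, ← pow_succ'] at h3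
        exact h3.symm
      calc y * b ^ (k + 1) = y * b ^ k * b := by rw [pow_succ, mul_assoc]
        _ = b ^ k * y ^ (t + 1) ^ k * (w ^ l' * b) := by rw [hl', mul_assoc]
        _ = b ^ k * (y ^ (t + 1) ^ k * b) * w ^ l' := by
          rw [((hwc b).pow_left l').eq]; simp only [mul_assoc]
        _ = _ := by rw [h1, pow_succ b, pow_add w]; simp only [mul_assoc]
  set i := p ^ (n - s) * j with hi
  have hit : i * t = p ^ n * (j * t') := by
    rw [hi, htdef, show p ^ (n - s) * j * (p ^ s * t') = p ^ (n - s) * p ^ s * (j * t') by ring,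
      ← pow_add, Nat.sub_add_cancel hsn]
  obtain ⟨l', hl'⟩ := hyk i
  have hmod : (t + 1) ^ i ≡ 1 [MOD p ^ n] :=
    pow_dvd_add_one_pow_sub_one hpt ⟨_, hit⟩ hp
  obtain ⟨r, hr⟩ : ∃ r, (t + 1) ^ i = 1 + p ^ n * r := by
    obtain ⟨r, hr⟩ := (Nat.modEq_iff_dvd' (Nat.one_le_pow _ _ (Nat.succ_pos t))).1 hmod.symm
    exact ⟨r, by rw [← hr, Nat.add_sub_cancel' (Nat.one_le_pow _ _ (Nat.succ_pos t))]⟩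
  set c := (y ^ p ^ n) ^ r * w ^ l' with hc
  have hcc : ∀ g, Commute c g := fun g =>
    ((hG.pow_commute hexp y g).pow_left r).mul_left ((hwc g).pow_left l')
  have hcp : c ^ p = 1 := by
    rw [hc, (((hwc _).pow_left l').symm).mul_pow, pow_right_comm, hpp, pow_right_comm, hpp,
      one_pow, one_pow, one_mul]
  have hyc : y * b ^ i = b ^ i * y * c := by
    rw [hl', hr, pow_add, pow_one, pow_mul y, hc]
    simp only [mul_assoc]
  refine ⟨i, ?_⟩
  have h1 := mul_pow_of_commutator_pow_eq_one hyc (hcc _) (hcc _) hcp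
    (dvd_choose_two hp (Or.inl ht) : p ∣ t.choose 2)
  have h2 : (b ^ i) ^ t = w ^ l := by rw [← pow_mul, hit, pow_mul, ← hw, hj]
  unfold PowConj
  rw [pow_succ', h1, h2, mul_assoc, hy]
  calc b ^ i * (b * y ^ (t + 1) * w ^ l) = b * b ^ i * y * (y ^ t * w ^ l) := by
        simp only [← mul_assoc]
        rw [← pow_succ b, ← pow_succ' b, pow_succ' y]
        simp only [mul_assoc]
    _ = _ := by rw [((hwc (y ^ t)).pow_left l).eq]; simp only [mul_assoc]

/-- The situation obtained by lifting a power triple of the quotient by a central subgroup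
generated by `ν`. -/
structure LiftedTriple (A : Subgroup G) (b : G) (t : ℕ) (ν : G) : Prop where
  normal : A.Normal
  mem : ν ∈ A
  comm : ∀ x ∈ A, ∀ y ∈ A, ∃ l : ℕ, y * x = x * y * ν ^ l
  gen : ∀ g, ∃ i : ℤ, ∃ a ∈ A, g = b ^ i * a
  conj : ∀ y ∈ A, ∃ l : ℕ, y * b = b * y ^ (t + 1) * ν ^ l

/-- Elements of A commute up to powers of ν, so a changes the action of b only within the allowed
error. This gives freedom in the choice of b. -/
theorem LiftedTriple.mul_right {A : Subgroup G} {b : G} {t : ℕ} {ν : G}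
    (h : LiftedTriple A b t ν) (hν : ∀ g, Commute ν g) {a : G} (ha : a ∈ A) :
    LiftedTriple A (b * a) t ν where
  normal := h.normal
  mem := h.mem
  comm := h.comm
  gen := by
    intro g
    obtain ⟨i, a', ha', rfl⟩ := h.gen g
    have := h.normal
    refine ⟨i, ((b * a) ^ i)⁻¹ * (b ^ i * a'), ?_, (mul_inv_cancel_left _ _).symm⟩
    rw [← QuotientGroup.eq_one_iff] at ha ha' ⊢
    simp [ha, ha']
  conj := by
    intro y hy
    obtain ⟨l, hl⟩ := h.conj y hy
    obtain ⟨m, hm⟩ := h.comm a ha (y ^ (t + 1)) (A.pow_mem hy _)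
    refine ⟨m + l, ?_⟩
    calc y * (b * a) = b * y ^ (t + 1) * (ν ^ l * a) := by rw [← mul_assoc, hl, mul_assoc]
      _ = b * (y ^ (t + 1) * a) * ν ^ l := by
        rw [((hν a).pow_left l).eq]; simp only [mul_assoc]
      _ = _ := by rw [hm, pow_add ν]; simp only [mul_assoc]

theorem LiftedTriple.hasPowerTriple (hG : IsFinHerPowerful p G) {n : ℕ}
    (hexp : ∀ g : G, g ^ p ^ (n + 1) = 1) {A : Subgroup G} {b : G} {t : ℕ} {ν : G}
    (h : LiftedTriple A b t ν) (ht : powerfulExponent p ∣ t) (htn : ¬ p ^ (n + 1) ∣ t)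
    (hb : b ^ p ^ n ≠ 1) (hν : ν ∈ Subgroup.zpowers (b ^ p ^ n)) : HasPowerTriple p G := by
  have := Fact.mk hG.prime
  have := hG.finite
  obtain ⟨m, hm⟩ := (mem_powers_iff_mem_zpowers).2 hν
  simp only at hm
  refine hG.hasPowerTriple_of_closure hexp (orderOf_eq_prime_pow hb (hexp b)) ht fun g => ?_
  obtain ⟨i, a, ha, rfl⟩ := h.gen g
  obtain ⟨l, hl⟩ := h.conj a ha
  rw [← hm, ← pow_mul] at hl
  obtain ⟨j, hj⟩ := hG.exists_powConj_pow_mul hexp ht htn hl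
  refine ⟨i - j, b ^ j * a, Subgroup.subset_closure hj, ?_⟩
  rw [zpow_sub, zpow_natCast]
  group

/-- Take a translate of minimal order. If its socle lay in the given subgroup, multiplying by
suitable powers of a and b would cancel it, by multiplicativity of the p^k-th power, and lower the
order. -/
theorem exists_minimal_translate (hG : IsFinHerPowerful p G) {n : ℕ}
    (hexp : ∀ g : G, g ^ p ^ (n + 1) = 1) (a b c : G) : ∃ x y : ℕ, a ^ x * c * b ^ y = 1 ∨
      ∃ k, orderOf (a ^ x * c * b ^ y) = p ^ (k + 1) ∧
        (a ^ x * c * b ^ y) ^ p ^ k ∉ Subgroup.closure {a ^ p ^ n, b ^ p ^ n} := by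
  have hp := hG.prime
  have := hG.finite
  obtain ⟨⟨x, y⟩, hxy⟩ : ∃ q : ℕ × ℕ, ∀ q' : ℕ × ℕ,
      orderOf (a ^ q.1 * c * b ^ q.2) ≤ orderOf (a ^ q'.1 * c * b ^ q'.2) := by
    let f : ℕ × ℕ → ℕ := fun q => orderOf (a ^ q.1 * c * b ^ q.2)
    obtain ⟨q, hq⟩ := Nat.sInf_mem (Set.range_nonempty f)
    exact ⟨q, fun q' => hq.trans_le (Nat.sInf_le ⟨q', rfl⟩)⟩
  refine ⟨x, y, ?_⟩
  by_contra hcon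
  push Not at hcon
  obtain ⟨h1, h2⟩ := hcon
  obtain ⟨k, hk⟩ := hG.exists_orderOf h1
  have hkn : k ≤ n := by
    have := orderOf_dvd_of_pow_eq_one (hexp (a ^ x * c * b ^ y))
    rw [hk, Nat.pow_dvd_pow_iff_le_right hp.one_lt] at this
    omega
  obtain ⟨i', j', hij⟩ := hG.exists_zpow_mul_zpow (inv_mem (h2 k hk))
  obtain ⟨i, hi⟩ := exists_npow_eq_zpow (a ^ p ^ n) i'
  obtain ⟨j, hj⟩ := exists_npow_eq_zpow (b ^ p ^ n) j'
  rw [← hi, ← hj] at hij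
  set u := a ^ x * c * b ^ y with hu
  have e : ∀ (z : G) (i : ℕ), (z ^ (p ^ (n - k) * i)) ^ p ^ k = (z ^ p ^ n) ^ i := by
    intro z i
    rw [← pow_mul, ← pow_mul, mul_right_comm, ← pow_add, Nat.sub_add_cancel hkn]
  have e' : ∀ (z : G) (i : ℕ), (z ^ (p ^ (n - k) * i)) ^ p ^ (k + 1) = 1 := by
    intro z i
    rw [pow_succ, pow_mul, e, pow_right_comm (z ^ p ^ n), ← pow_mul z, ← pow_succ, hexp, one_pow]
  have hu1 : u ^ p ^ (k + 1) = 1 := by rw [← hk, pow_orderOf_eq_one]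
  have h3 : (a ^ (p ^ (n - k) * i) * u * b ^ (p ^ (n - k) * j)) ^ p ^ k = 1 := by
    rw [mul_pow_prime_pow k hG (mul_pow_eq_one _ hG (e' _ _) hu1) (e' _ _),
      mul_pow_prime_pow k hG (e' _ _) hu1, e, e]
    have hc : Commute ((b ^ p ^ n) ^ j) ((a ^ p ^ n) ^ i * u ^ p ^ k) :=
      (hG.pow_commute hexp b _).pow_left j
    have hc2 : Commute ((b ^ p ^ n) ^ j) ((a ^ p ^ n) ^ i) :=
      (hG.pow_commute hexp b _).pow_left j
    rw [← hc.eq, ← mul_assoc, hc2.eq, ← hij, inv_mul_cancel]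
  have h4 := hxy (p ^ (n - k) * i + x, y + p ^ (n - k) * j)
  simp only at h4
  have h5 : a ^ (p ^ (n - k) * i + x) * c * b ^ (y + p ^ (n - k) * j) =
      a ^ (p ^ (n - k) * i) * u * b ^ (p ^ (n - k) * j) := by
    rw [hu, pow_add, pow_add]; simp only [mul_assoc]
  rw [h5] at h4
  exact absurd (orderOf_lt_of_pow_eq_one hp hk h3) (not_lt.2 h4)

/-- A nontrivial error would put ν into ⟨b, c b^y⟩. Elements of order p there are products from the
socles of b and of c b^y; the latter is independent of ν and b^(p^n), so ν would be a power of
b^(p^n). -/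
theorem LiftedTriple.powConj_of_socle (hG : IsFinHerPowerful p G) {n : ℕ}
    (hexp : ∀ g : G, g ^ p ^ (n + 1) = 1) {A : Subgroup G} {b : G} {t : ℕ} {ν : G}
    (h : LiftedTriple A b t ν) (hνp : ν ^ p = 1) (hν : ν ∉ Subgroup.zpowers (b ^ p ^ n))
    (hb : b ^ p ^ n ≠ 1)
    {c : G} (hc : c ∈ A) {y : ℕ} (hu : c * b ^ y = 1 ∨ ∃ k, orderOf (c * b ^ y) = p ^ (k + 1) ∧
      (c * b ^ y) ^ p ^ k ∉ Subgroup.closure {ν, b ^ p ^ n}) : PowConj b t c := by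
  have hp := hG.prime
  have := Fact.mk hp
  obtain ⟨l, hl⟩ := h.conj c hc
  by_contra hcon
  have hl1 : ν ^ (l : ℤ) ≠ 1 := by
    intro h
    rw [zpow_natCast] at h
    rw [h, mul_one] at hl
    exact hcon hl
  set H := Subgroup.closure {b, c * b ^ y} with hH
  have hbH : b ∈ H := Subgroup.subset_closure (by simp)
  have huH : c * b ^ y ∈ H := Subgroup.subset_closure (by simp)
  have hcH : c ∈ H := (H.mul_mem_cancel_right (H.pow_mem hbH y)).1 huH
  have hνH : ν ∈ H := by
    refine mem_of_zpow_mem_of_ne_one hp hνp (i := l) ?_ hl1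
    rw [zpow_natCast, ← (inv_mul_eq_iff_eq_mul).2 hl]
    exact H.mul_mem (H.inv_mem (H.mul_mem hbH (H.pow_mem hcH _))) (H.mul_mem hcH hbH)
  have hbo : orderOf b = p ^ (n + 1) := orderOf_eq_prime_pow hb (hexp b)
  rcases hu with hu | ⟨k, hk, hk2⟩
  · obtain ⟨i, j, hij⟩ := hG.exists_zpow_mul_zpow hνH
    rw [hu, one_zpow, mul_one] at hij
    exact hν (mem_zpowers_pow_of_pow_eq_one hp hbo ⟨i, hij.symm⟩ hνp)
  · set K := Subgroup.closure {ν, b ^ p ^ n} with hK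
    have hνK : ν ∈ K := Subgroup.subset_closure (by simp)
    have hwK : b ^ p ^ n ∈ K := Subgroup.subset_closure (by simp)
    obtain ⟨i, j, hij⟩ := hG.exists_socle_of_mem_closure hbo hk
      (fun h => hk2 ((Subgroup.zpowers_le).2 hwK h)) hνH hνp
    have h1 : ((c * b ^ y) ^ p ^ k) ^ j = 1 := by
      refine zpow_eq_one_of_mem hp ?_ hk2 (H := K) ?_
      · rw [← pow_mul, ← pow_succ, ← hk, pow_orderOf_eq_one]
      · rw [← (inv_mul_eq_iff_eq_mul).2 hij]
        exact K.mul_mem (K.inv_mem (K.zpow_mem hwK _)) hνK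
    rw [h1, mul_one] at hij
    exact hν ⟨i, hij.symm⟩

/-- Each c in A has a translate a^x c satisfying the exact relation. If a satisfies it too, this
suffices. Otherwise the error of a is itself a power of a, so a satisfies the relation for t + p^n
l; the exact elements are killed by p^n and do not notice the change of t. -/
theorem LiftedTriple.hasPowerTriple_of_mem (hG : IsFinHerPowerful p G) {n : ℕ}
    (hexp : ∀ g : G, g ^ p ^ (n + 1) = 1) (hn : powerfulExponent p ∣ p ^ n)
    {A : Subgroup G} {b a : G} {t : ℕ}
    (h : LiftedTriple A b t (a ^ p ^ n)) (ht : powerfulExponent p ∣ t)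
    (ha : a ∈ A) (ha1 : a ^ p ^ n ≠ 1) (hb : b ^ p ^ n ∉ Subgroup.zpowers (a ^ p ^ n))
    (hbA : ∀ y ∈ A, y ^ p ^ n ≠ b ^ p ^ n) : HasPowerTriple p G := by
  have hp := hG.prime
  have := Fact.mk hp
  have := hG.finite
  set ν := a ^ p ^ n with hν
  set w := b ^ p ^ n with hw
  have hpp : ∀ g : G, (g ^ p ^ n) ^ p = 1 := fun g => by rw [← pow_mul, ← pow_succ, hexp]
  have hνc : ∀ g, Commute ν g := fun g => hG.pow_commute hexp a g
  have hwc : ∀ g, Commute w g := fun g => hG.pow_commute hexp b g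
  have hπ : ∀ g h : G, (g * h) ^ p ^ n = g ^ p ^ n * h ^ p ^ n := fun g h =>
    mul_pow_prime_pow n hG (hexp g) (hexp h)
  have hw1 : w ≠ 1 := fun h => hb (h ▸ Subgroup.one_mem _)
  have hbo : orderOf b = p ^ (n + 1) := orderOf_eq_prime_pow hw1 (hexp b)
  have hνw : ν ∉ Subgroup.zpowers w := by
    rintro ⟨i, hi⟩
    simp only at hi
    exact hb (mem_of_zpow_mem_of_ne_one hp (hpp b) (i := i) (by rw [hi]; exact Subgroup.mem_zpowers ν)
      (by rw [hi]; exact ha1))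
  have key : ∀ c ∈ A, ∃ x : ℕ, PowConj b t (a ^ x * c) ∧ ∃ y : ℕ, (a ^ x * c * b ^ y = 1 ∨
      ∃ k, orderOf (a ^ x * c * b ^ y) = p ^ (k + 1) ∧
        (a ^ x * c * b ^ y) ^ p ^ k ∉ Subgroup.closure {ν, w}) := by
    intro c hc
    obtain ⟨x, y, hxy⟩ := hG.exists_minimal_translate hexp a b c
    exact ⟨x, h.powConj_of_socle hG hexp (hpp a) hνw hw1 (A.mul_mem (A.pow_mem ha x) hc) hxy,
      y, hxy⟩
  by_cases hta : PowConj b t a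
  · refine hG.hasPowerTriple_of_closure hexp hbo ht fun g => ?_
    obtain ⟨i, c, hc, rfl⟩ := h.gen g
    obtain ⟨x, hx, -⟩ := key c hc
    refine ⟨i, c, ?_, rfl⟩
    exact (Subgroup.mul_mem_cancel_left _ (Subgroup.pow_mem _
      (Subgroup.subset_closure (show a ∈ {y | PowConj b t y} from hta)) x)).1 (Subgroup.subset_closure hx)
  obtain ⟨l, hl⟩ := h.conj a ha
  have hl1 : ν ^ l ≠ 1 := by
    intro h1
    rw [h1, mul_one] at hl
    exact hta hl
  have hta' : PowConj b (t + p ^ n * l) a := by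
    unfold PowConj
    rw [hl, add_right_comm, pow_add a (t + 1), pow_mul a, mul_assoc]
  -- If c^(p^n) were nontrivial it would lie outside ⟨ν, w⟩, hence so would (ca)^(p^n). Then c and
  -- ca would both be exact, and so would a.
  have hclaim : ∀ c ∈ A, PowConj b t c → c ^ p ^ n = 1 := by
    intro c hc hct
    by_contra hc1
    have hnot : c ^ p ^ n ∉ Subgroup.closure {ν, w} := by
      obtain ⟨x, hx, y, hxy⟩ := key c hc
      -- Both c and a^x c are exact, hence so is a^x; but its error is ν^(xl) with ν^l nontrivial,
      -- so p divides x.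
      have hνx : ν ^ x = 1 := by
        obtain ⟨m, hm⟩ := h.comm (a ^ x) (A.pow_mem ha x) c hc
        have h1 : PowConj b t (a ^ x) := hx.of_mul_left hp ht hct hm ((hνc _).pow_left m)
          ((hνc _).pow_left m) (by rw [pow_right_comm, hpp, one_pow])
        have h2 : a ^ x * b = b * (a ^ x) ^ (t + 1) * ν ^ (x * l) := by
          have h3 : SemiconjBy b (a ^ (t + 1) * ν ^ l) a := by rw [SemiconjBy, hl, mul_assoc]
          have h4 := h3.pow_right x
          rw [(((hνc (a ^ (t + 1))).pow_left l).symm).mul_pow, ← pow_mul, ← pow_mul,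
            mul_comm (t + 1), mul_comm l, pow_mul] at h4
          rw [mul_assoc]
          exact h4.symm
        unfold PowConj at h1
        rw [h1] at h2
        have h3 : ν ^ (x * l) = 1 := mul_eq_left.1 h2.symm
        rw [← orderOf_dvd_iff_pow_eq_one, orderOf_eq_prime (hpp a) ha1] at h3 ⊢
        refine (hp.dvd_mul.1 h3).resolve_right fun hd => hl1 ?_
        obtain ⟨d, rfl⟩ := hd
        rw [pow_mul, hpp, one_pow]
      have hπu : (a ^ x * c * b ^ y) ^ p ^ n = c ^ p ^ n * w ^ y := by
        rw [hπ, hπ, pow_right_comm, ← hν, hνx, one_mul, pow_right_comm b, ← hw]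
      have hπu1 : (a ^ x * c * b ^ y) ^ p ^ n ≠ 1 := by
        intro h1
        rw [hπu] at h1
        have h2 := eq_inv_of_mul_eq_one_left h1
        rw [← zpow_natCast w, ← zpow_neg] at h2
        have h3 : w ∈ Subgroup.zpowers (c ^ p ^ n) :=
          mem_of_zpow_mem_of_ne_one hp (hpp b) (i := -y) (by rw [← h2]; exact Subgroup.mem_zpowers _)
            (by rw [← h2]; exact hc1)
        obtain ⟨m, hm⟩ := (mem_powers_iff_mem_zpowers).2 h3
        simp only at hm
        refine hbA (c ^ m) (A.pow_mem hc m) ?_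
        rw [pow_right_comm, hm]
      rcases hxy with h1 | ⟨k, hk, hk2⟩
      · exact absurd (by rw [h1, one_pow]) hπu1
      · rw [orderOf_eq_prime_pow hπu1 (hexp _)] at hk
        have := Nat.pow_right_injective hp.two_le hk
        obtain rfl : n = k := by simpa using this
        rw [hπu] at hk2
        intro h2
        exact hk2 (Subgroup.mul_mem _ h2 (Subgroup.pow_mem _ (Subgroup.subset_closure (by simp)) y))
    have hca : (c * a) ^ p ^ n ∉ Subgroup.closure {ν, w} := by
      rw [hπ, ← hν]
      intro h1
      exact hnot ((Subgroup.mul_mem_cancel_right _ (Subgroup.subset_closure (by simp))).1 h1)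
    have hcaP : PowConj b t (c * a) := by
      refine h.powConj_of_socle hG hexp (hpp a) hνw hw1 (A.mul_mem hc ha) (y := 0) (Or.inr ⟨n, ?_⟩)
      rw [pow_zero, mul_one]
      refine ⟨orderOf_eq_prime_pow ?_ (hexp _), hca⟩
      intro h1
      exact hca (h1 ▸ Subgroup.one_mem _)
    obtain ⟨m, hm⟩ := h.comm c hc a ha
    exact hta (hcaP.of_mul_right hp ht hct hm ((hνc _).pow_left m)
          ((hνc _).pow_left m) (by rw [pow_right_comm, hpp, one_pow]))
  refine hG.hasPowerTriple_of_closure hexp hbo (t := t + p ^ n * l)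
    (dvd_add ht (hn.mul_right l)) fun g => ?_
  obtain ⟨i, c, hc, rfl⟩ := h.gen g
  obtain ⟨x, hx, -⟩ := key c hc
  refine ⟨i, c, ?_, rfl⟩
  have hx' : PowConj b (t + p ^ n * l) (a ^ x * c) := by
    have h1 := hclaim _ (A.mul_mem (A.pow_mem ha x) hc) hx
    unfold PowConj at hx ⊢
    rw [hx, add_right_comm, pow_add _ (t + 1), pow_mul, h1, one_pow, mul_one]
  exact (Subgroup.mul_mem_cancel_left _ (Subgroup.pow_mem _
      (Subgroup.subset_closure (show a ∈ {y | PowConj b _ y} from hta')) x)).1 (Subgroup.subset_closure hx')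

end IsFinHerPowerful

/-! ### Iwasawa's theorem by induction on the order -/

namespace IsFinHerPowerful

variable {p : ℕ} {G : Type u} [Group G]

theorem exists_orderOf_eq_exponent (hG : IsFinHerPowerful p G) :
    ∃ b : G, ∀ g : G, g ^ orderOf b = 1 := by
  have := Fact.mk hG.prime
  obtain ⟨k, hk, hk2⟩ := hG.exists_exponent
  cases k with
  | zero => exact ⟨1, fun g => by simpa using hk g⟩
  | succ n =>
    obtain ⟨b, hb⟩ := hk2 n (Nat.lt_succ_self n)
    exact ⟨b, fun g => by rw [orderOf_eq_prime_pow hb (hk b), hk]⟩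

theorem hasPowerTriple_of_commute (hG : IsFinHerPowerful p G) (h : ∀ x y : G, Commute x y) :
    HasPowerTriple p G := by
  obtain ⟨b, hb⟩ := hG.exists_orderOf_eq_exponent
  exact ⟨⊤, b, 0, dvd_zero _, inferInstance, fun x _ y _ => h x y,
    fun g => ⟨0, g, trivial, by simp⟩, fun a _ => by simp [PowConj, (h a b).eq], hb⟩

/-- If the p^n-th powers are not all in one subgroup of order p, two independent ones exist, and a
nontrivial commutator cannot lie in both subgroups they generate. So one may divide without lowering
the exponent or making u and v commute. -/
theorem exists_pow_ne_one_of_not_commute (hG : IsFinHerPowerful p G) {n : ℕ}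
    (hexp : ∀ g : G, g ^ p ^ (n + 1) = 1) (hmin : ∀ j < n + 1, ∃ g : G, g ^ p ^ j ≠ 1)
    {u v : G} (huv : ¬ Commute u v) : ∃ x : G, x ^ p ^ n ≠ 1 ∧
      ((∀ g : G, g ^ p ^ n ∈ Subgroup.zpowers (x ^ p ^ n)) ∨
        ((∃ g : G, g ^ p ^ n ∉ Subgroup.zpowers (x ^ p ^ n)) ∧
          ⁅u, v⁆ ∉ Subgroup.zpowers (x ^ p ^ n))) := by
  have hp := hG.prime
  have hpp : ∀ g : G, (g ^ p ^ n) ^ p = 1 := fun g => by rw [← pow_mul, ← pow_succ, hexp]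
  obtain ⟨x, hx⟩ := hmin n (Nat.lt_succ_self n)
  by_cases h1 : ∀ g : G, g ^ p ^ n ∈ Subgroup.zpowers (x ^ p ^ n)
  · exact ⟨x, hx, Or.inl h1⟩
  push Not at h1
  by_cases h2 : ⁅u, v⁆ ∈ Subgroup.zpowers (x ^ p ^ n)
  swap
  · exact ⟨x, hx, Or.inr ⟨h1, h2⟩⟩
  obtain ⟨y, hy⟩ := h1
  have hy1 : y ^ p ^ n ≠ 1 := fun h => hy (h ▸ Subgroup.one_mem _)
  have hxy : x ^ p ^ n ∉ Subgroup.zpowers (y ^ p ^ n) := by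
    rintro ⟨i, hi⟩
    simp only at hi
    exact hy (mem_of_zpow_mem_of_ne_one hp (hpp y) (i := i)
      (by rw [hi]; exact Subgroup.mem_zpowers _) (by rw [hi]; exact hx))
  refine ⟨y, hy1, Or.inr ⟨⟨x, hxy⟩, fun h3 => huv ?_⟩⟩
  rw [← commutatorElement_eq_one_iff_commute]
  obtain ⟨i, hi⟩ := h2
  simp only at hi
  rw [← hi] at h3 ⊢
  exact zpow_eq_one_of_mem hp (hpp x) hxy h3

theorem lift_triple (hG : IsFinHerPowerful p G) {ν : G} [hN : (Subgroup.zpowers ν).Normal]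
    {A' : Subgroup (G ⧸ Subgroup.zpowers ν)} (hA' : A'.Normal)
    {b : G} {t : ℕ} (hcomm : ∀ x ∈ A', ∀ y ∈ A', Commute x y)
    (hgen : ∀ g, ∃ i : ℤ, ∃ a ∈ A', g = (b : G ⧸ Subgroup.zpowers ν) ^ i * a)
    (hconj : ∀ a ∈ A', PowConj (b : G ⧸ Subgroup.zpowers ν) t a) :
    LiftedTriple (A'.comap (QuotientGroup.mk' (Subgroup.zpowers ν))) b t ν := by
  have := hG.finite
  have key : ∀ g h : G, (g : G ⧸ Subgroup.zpowers ν) = h → ∃ l : ℕ, h = g * ν ^ l := by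
    intro g h hgh
    rw [QuotientGroup.eq] at hgh
    obtain ⟨l, hl⟩ := (mem_powers_iff_mem_zpowers).2 hgh
    simp only at hl
    exact ⟨l, by rw [hl, mul_inv_cancel_left]⟩
  refine ⟨inferInstance, ?_, ?_, ?_, ?_⟩
  · rw [Subgroup.mem_comap, QuotientGroup.mk'_apply,
      (QuotientGroup.eq_one_iff ν).2 (Subgroup.mem_zpowers ν)]
    exact A'.one_mem
  · intro x hx y hy
    exact key _ _ (hcomm x hx y hy)
  · intro g
    obtain ⟨i, a, ha, hia⟩ := hgen g
    refine ⟨i, (b ^ i)⁻¹ * g, ?_, (mul_inv_cancel_left _ _).symm⟩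
    rw [Subgroup.mem_comap, QuotientGroup.mk'_apply, QuotientGroup.mk_mul, QuotientGroup.mk_inv,
      QuotientGroup.mk_zpow, hia, inv_mul_cancel_left]
    exact ha
  · intro y hy
    exact key _ _ (hconj y hy).symm

/-- **Iwasawa's theorem**, in the form due to Lubotzky and Mann: the structure of finite
`p`-groups all of whose two-generated subgroups are powerful. -/
theorem hasPowerTriple (hG : IsFinHerPowerful p G) : HasPowerTriple p G := by
  refine quotient_induction (p := p) (P := fun G _ => HasPowerTriple p G) ?_ G hG
  intro G _ hG ih
  by_cases hab : ∀ x y : G, Commute x y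
  · exact hG.hasPowerTriple_of_commute hab
  push Not at hab
  obtain ⟨r, s, hrs⟩ := hab
  have hp := hG.prime
  have := Fact.mk hp
  have := hG.finite
  obtain ⟨k, hexp, hmin⟩ := hG.exists_exponent
  obtain ⟨n, rfl⟩ : ∃ n, k = n + 1 := by
    refine Nat.exists_eq_succ_of_ne_zero ?_
    rintro rfl
    simp only [pow_zero, pow_one] at hexp
    exact hrs (by rw [hexp r]; exact Commute.one_left s)
  have hn : powerfulExponent p ∣ p ^ n := by
    obtain ⟨e, he⟩ := exists_powerfulExponent_eq_pow p
    rw [he]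
    by_contra hcon
    have hle : n + 1 ≤ e := by
      by_contra h
      exact hcon (pow_dvd_pow p (by omega))
    refine hrs (hG.commute_of_forall_pow_eq_one fun g _ => ?_)
    obtain ⟨d, hd⟩ := pow_dvd_pow p hle
    rw [he, hd, pow_mul, hexp, one_pow]
  have hpp : ∀ g : G, (g ^ p ^ n) ^ p = 1 := fun g => by rw [← pow_mul, ← pow_succ, hexp]
  have hπ : ∀ g h : G, (g * h) ^ p ^ n = g ^ p ^ n * h ^ p ^ n := fun g h =>
    mul_pow_prime_pow n hG (hexp g) (hexp h)
  obtain ⟨x, hx, hx2⟩ := hG.exists_pow_ne_one_of_not_commute hexp hmin hrs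
  set ν := x ^ p ^ n with hν
  have hνc : ∀ g, Commute ν g := fun g => hG.pow_commute hexp x g
  have hnor : (Subgroup.zpowers ν).Normal := normal_zpowers_of_mem_center
    (Subgroup.mem_center_iff.2 fun g => (hνc g).symm)
  obtain ⟨A', b', t, ht, hA', hcomm, hgen, hconj, hord⟩ :=
    ih (Subgroup.zpowers ν) (by simpa using hx)
  obtain ⟨b, rfl⟩ := QuotientGroup.mk_surjective b'
  have hL := hG.lift_triple hA' hcomm hgen hconj
  set A := A'.comap (QuotientGroup.mk' (Subgroup.zpowers ν)) with hA
  have hmem : ∀ z : G, z ^ p ^ n ∈ Subgroup.zpowers ν → z ^ p ^ n ≠ 1 →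
      ν ∈ Subgroup.zpowers (z ^ p ^ n) := by
    rintro z ⟨i, hi⟩ hz1
    simp only at hi
    exact mem_of_zpow_mem_of_ne_one hp (hpp x) (i := i)
      (by rw [hi]; exact Subgroup.mem_zpowers _) (by rw [hi]; exact hz1)
  rcases hx2 with hx2 | ⟨⟨g₀, hg₀⟩, hx2⟩
  · obtain ⟨a, ha, hba⟩ : ∃ a ∈ A, (b * a) ^ p ^ n ≠ 1 := by
      by_cases hb : b ^ p ^ n = 1
      · obtain ⟨i, a, ha, hia⟩ := hL.gen x
        refine ⟨a, ha, ?_⟩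
        rw [hπ, hb, one_mul]
        have h1 : (b ^ i) ^ p ^ n = 1 := by
          rw [← zpow_natCast, zpow_comm, zpow_natCast, hb, one_zpow]
        rwa [hν, hia, hπ, h1, one_mul] at hx
      · exact ⟨1, A.one_mem, by rwa [mul_one]⟩
    have hL1 := hL.mul_right hνc ha
    have hmem1 := hmem _ (hx2 (b * a)) hba
    by_cases htn : p ^ n ∣ t
    -- Here all p^n-th powers lie in ⟨ν⟩, so a multiple of p^n in the exponent only changes the
    -- error. Replacing t by p^n ensures that p^(n+1) does not divide it.
    · refine LiftedTriple.hasPowerTriple hG hexp (t := p ^ n) ⟨hL1.normal, hL1.mem, hL1.comm,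
        hL1.gen, ?_⟩ hn ?_ hba hmem1
      · intro y hy
        obtain ⟨l, hl⟩ := hL1.conj y hy
        obtain ⟨d, rfl⟩ := htn
        obtain ⟨i, hi⟩ := (mem_powers_iff_mem_zpowers).2 (hx2 y)
        obtain ⟨j, hj⟩ := (mem_powers_iff_mem_zpowers).2 (inv_mem (hx2 y))
        simp only at hi hj
        refine ⟨j + (i * d + l), ?_⟩
        rw [hl, pow_succ', pow_mul, ← hi, pow_succ' y, ← hi]
        have h1 : ν ^ i * ν ^ j = 1 := by rw [hi, hj, mul_inv_cancel]
        rw [pow_add ν j, pow_add, ← pow_mul]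
        simp only [mul_assoc]
        rw [← mul_assoc (ν ^ i) (ν ^ j), h1, one_mul]
      · rw [Nat.pow_dvd_pow_iff_le_right hp.one_lt]; omega
    · exact LiftedTriple.hasPowerTriple hG hexp hL1 ht
        (fun h => htn ((pow_dvd_pow p (Nat.le_succ n)).trans h)) hba hmem1
  -- The order of b in the quotient is the exponent there, which is still p^(n+1) because of g₀.
  have hb : b ^ p ^ n ∉ Subgroup.zpowers ν := by
    intro h
    have h1 : ((b : G) : G ⧸ Subgroup.zpowers ν) ^ p ^ n = 1 := by
      rw [← QuotientGroup.mk_pow, QuotientGroup.eq_one_iff]; exact h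
    apply hg₀
    rw [← QuotientGroup.eq_one_iff, QuotientGroup.mk_pow]
    obtain ⟨d, hd⟩ := orderOf_dvd_of_pow_eq_one h1
    rw [hd, pow_mul, hord, one_pow]
  have htn : ¬ p ^ (n + 1) ∣ t := by
    rintro ⟨d, hd⟩
    have h1 : ∀ a ∈ A', Commute a (b : G ⧸ Subgroup.zpowers ν) := by
      intro a ha
      have := hconj a ha
      obtain ⟨a₀, rfl⟩ := QuotientGroup.mk_surjective a
      unfold PowConj at this
      rwa [pow_succ, hd, pow_mul, ← QuotientGroup.mk_pow, hexp, QuotientGroup.mk_one, one_pow,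
        one_mul] at this
    have h2 : Commute (r : G ⧸ Subgroup.zpowers ν) (s : G ⧸ Subgroup.zpowers ν) := by
      obtain ⟨i, a, ha, hia⟩ := hgen r
      obtain ⟨j, c, hc, hjc⟩ := hgen s
      rw [hia, hjc]
      exact (((Commute.refl _).zpow_zpow i j).mul_right (((h1 c hc).symm).zpow_left i)).mul_left
        (((h1 a ha).zpow_right j).mul_right (hcomm a ha c hc))
    apply hx2
    rw [← QuotientGroup.eq_one_iff]
    exact commutatorElement_eq_one_iff_commute.2 h2
  by_cases hex : ∃ a ∈ A, (b * a) ^ p ^ n ∈ Subgroup.zpowers ν ∧ (b * a) ^ p ^ n ≠ 1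
  · obtain ⟨a, ha, h1, h2⟩ := hex
    exact LiftedTriple.hasPowerTriple hG hexp (hL.mul_right hνc ha) ht htn h2 (hmem _ h1 h2)
  push Not at hex
  have hb1 : b ^ p ^ n ≠ 1 := fun h => hb (h ▸ Subgroup.one_mem _)
  obtain ⟨i, a, ha, hia⟩ := hL.gen x
  have hνia : ν = (b ^ p ^ n) ^ i * a ^ p ^ n := by
    rw [hν, hia, hπ]
    congr 1
    rw [← zpow_natCast, zpow_comm, zpow_natCast]
  have hbi : (b ^ p ^ n) ^ i = 1 := by
    by_contra hbi
    obtain ⟨j, hj⟩ := mem_of_zpow_mem_of_ne_one hp (hpp b)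
      (Subgroup.mem_zpowers ((b ^ p ^ n) ^ i)) hbi
    simp only at hj
    -- The exponent j inverts i on b^(p^n), so ν^j has the b-part of b itself. The excluded case
    -- then gives ν^j = 1, whence b^(p^n) = 1.
    have h1 : (b * a ^ j) ^ p ^ n = ν ^ j := by
      have hc : Commute ((b ^ p ^ n) ^ i) (a ^ p ^ n) := (hG.pow_commute hexp b _).zpow_left i
      rw [hπ, hνia, hc.mul_zpow, hj]
      congr 1
      rw [← zpow_natCast, zpow_comm, zpow_natCast]
    have h2 := hex (a ^ j) (A.zpow_mem ha j) (by rw [h1]; exact ⟨j, rfl⟩)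
    rw [h1] at h2
    have h3 := zpow_eq_one_of_zpow_eq_one hp (hpp x) hx (g := (b ^ p ^ n) ^ i)
      (by rw [← zpow_natCast, zpow_comm, zpow_natCast, hpp, one_zpow]) h2
    rw [hj] at h3
    exact hb1 h3
  rw [hbi, one_mul] at hνia
  rw [hνia] at hL hb hx
  refine hL.hasPowerTriple_of_mem hG hexp hn ht ha hx hb fun y hy hyb => ?_
  have h1 : (b * (y⁻¹ * a)) ^ p ^ n = ν := by
    rw [hπ, hπ, inv_pow, hyb, mul_inv_cancel_left, hνia]
  have h2 := hex (y⁻¹ * a) (A.mul_mem (A.inv_mem hy) ha)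
    (by rw [h1]; exact Subgroup.mem_zpowers ν)
  rw [h1, hνia] at h2
  exact hx h2

end IsFinHerPowerful

/-! ### Normalizing t + 1 to 1 + p^s -/

section Arithmetic

/-- Successive approximation: 1 + p^s d raised to p^(M-s) is 1 + p^M(d + py), and d is a unit modulo
p, so adding a multiple of p^(M-s) to κ corrects the next p-adic digit. -/
theorem exists_pow_sub_one_add_pow_dvd {p : ℕ} (hp : p.Prime) {s : ℕ} (hs : s ≠ 0)
    (hps : s + 2 ≤ p * s) {d : ℕ} (hd : ¬ p ∣ d) (M : ℕ) (hM : s ≤ M) :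
    ∃ κ : ℕ, ((p : ℤ) ^ M) ∣ (1 + p ^ s * d) ^ κ - (1 + p ^ s) := by
  induction M, hM using Nat.le_induction with
  | base => exact ⟨1, d - 1, by ring⟩
  | succ M hM ih =>
    obtain ⟨κ, z, hz⟩ := ih
    have hdvd : (p : ℕ) * p ^ s * p ∣ (p ^ s) ^ p := by
      rw [← pow_succ', ← pow_succ, ← pow_mul, mul_comm s]
      exact pow_dvd_pow _ hps
    obtain ⟨y, hy⟩ := ZMod.exists_one_add_mul_pow_prime_pow_eq (R := ℤ) (u := p ^ s) (v := p) hp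
      (dvd_pow_self _ hs) (by exact_mod_cast hdvd) d (M - s)
    rw [← pow_add, Nat.sub_add_cancel hM] at hy
    have hcop : IsCoprime (p : ℤ) d := Nat.isCoprime_iff_coprime.2 ((hp.coprime_iff_not_dvd).2 hd)
    obtain ⟨e, f, hef⟩ := hcop
    obtain ⟨j, hj⟩ : ∃ j : ℕ, (p : ℤ) ∣ z + j * d := by
      refine ⟨((-z * f) % p).toNat, ?_⟩
      rw [Int.toNat_of_nonneg (Int.emod_nonneg _ (by exact_mod_cast hp.ne_zero)), Int.emod_def]
      exact ⟨z * e - (-z * f) / p * d, by linear_combination -z * hef⟩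
    obtain ⟨g, hg⟩ := hj
    obtain ⟨q, hq⟩ := Polynomial.powAddExpansion (1 : ℤ) (p ^ M * (d + p * y)) j
    refine ⟨κ + p ^ (M - s) * j, ?_⟩
    have h1 : ((1 : ℤ) + p ^ s * d) ^ κ = 1 + p ^ s + p ^ M * z := by linarith
    rw [pow_add ((1:ℤ) + p ^ s * d), pow_mul ((1:ℤ) + p ^ s * d), hy, hq, h1]
    obtain ⟨s, rfl⟩ := Nat.exists_eq_succ_of_ne_zero hs
    obtain ⟨M, rfl⟩ : ∃ M', M = M' + 1 := ⟨M - 1, by omega⟩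
    simp only [one_pow, mul_one, Nat.succ_eq_add_one]
    refine ⟨g + j * y + p ^ s * j * (d + p * y) + p ^ M * z * j * (d + p * y) +
      (1 + p ^ (s + 1) + p ^ (M + 1) * z) * q * p ^ M * (d + p * y) ^ 2, ?_⟩
    linear_combination (p : ℤ) ^ (M + 1) * hg

theorem exists_coprime_pow_modEq {p : ℕ} (hp : p.Prime) {t : ℕ} (ht : powerfulExponent p ∣ t)
    {s d : ℕ} (htd : t = p ^ s * d) (hd : ¬ p ∣ d) (N : ℕ) :
    (1 ≤ s ∧ (p = 2 → 2 ≤ s)) ∧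
      ∃ κ : ℕ, p.Coprime κ ∧ (t + 1) ^ κ ≡ 1 + p ^ s [MOD p ^ N] := by
  have hs : 1 ≤ s := by
    by_contra h
    obtain rfl : s = 0 := by omega
    rw [pow_zero, one_mul] at htd
    exact hd (htd ▸ (dvd_powerfulExponent p).trans ht)
  have hs2 : p = 2 → 2 ≤ s := by
    rintro rfl
    by_contra h
    obtain rfl : s = 1 := by omega
    obtain ⟨k, rfl⟩ : 4 ∣ t := ht
    exact hd ⟨k, by omega⟩
  refine ⟨⟨hs, hs2⟩, ?_⟩
  have hps : s + 2 ≤ p * s := by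
    by_cases h2 : p = 2
    · have := hs2 h2
      subst h2
      omega
    · have : 3 ≤ p := by have := hp.two_le; omega
      nlinarith
  -- The precision covers p^N, needed for the conclusion, and p^(s+1), which shows κ prime to p:
  -- otherwise the power would be 1 modulo p^(s+1).
  obtain ⟨κ, hκ⟩ := exists_pow_sub_one_add_pow_dvd hp (by omega) hps hd (N + s + 1) (by omega)
  have hmod : (t + 1) ^ κ ≡ 1 + p ^ s [MOD p ^ (N + s + 1)] := by
    refine (Nat.modEq_iff_dvd.2 ?_).symm
    push_cast
    rw [htd]
    push_cast
    rw [add_comm ((p : ℤ) ^ s * d)]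
    exact hκ
  refine ⟨κ, ?_, hmod.of_dvd (pow_dvd_pow p (by omega))⟩
  rw [hp.coprime_iff_not_dvd]
  rintro ⟨k, rfl⟩
  have h1 : (t + 1) ^ (p * k) ≡ 1 [MOD p ^ (s + 1)] :=
    pow_dvd_add_one_pow_sub_one ((dvd_powerfulExponent p).trans ht)
      ⟨k * d, by rw [htd, pow_succ]; ring⟩ hp
  have h2 := (h1.symm.trans (hmod.of_dvd (pow_dvd_pow p (by omega))))
  rw [Nat.modEq_iff_dvd' (by omega), Nat.add_sub_cancel_left,
    Nat.pow_dvd_pow_iff_le_right hp.one_lt] at h2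
  omega

end Arithmetic

/-- `G = ⟨b⟩ A` with `A` abelian normal and `b` acting on `A` as `1 + p ^ s`. -/
structure IsModularTriple {G : Type u} [Group G] (p : ℕ) (A : Subgroup G) (b : G) (s : ℕ∞) :
    Prop where
  normal : A.Normal
  comm : ∀ x ∈ A, ∀ y ∈ A, x * y = y * x
  one_le : 1 ≤ s
  two_le : p = 2 → 2 ≤ s
  gen : ∀ g, ∃ i : ℤ, ∃ a ∈ A, g = b ^ i * a
  acts : ActsAsOnePlusPow p b A s

theorem IsFinHerPowerful.exists_isModularTriple {p : ℕ} {G : Type u} [Group G]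
    (hG : IsFinHerPowerful p G) : ∃ (A : Subgroup G) (b : G) (s : ℕ∞), IsModularTriple p A b s := by
  obtain ⟨A, b, t, ht, hA, hcomm, hgen, hconj, -⟩ := hG.hasPowerTriple
  obtain ⟨N, hN, -⟩ := hG.exists_exponent
  have hp := hG.prime
  have := Fact.mk hp
  have := hG.finite
  by_cases ht0 : t = 0
  · refine ⟨A, b, ⊤, hA, fun x hx y hy => hcomm x hx y hy, le_top, fun _ => le_top, hgen, ?_⟩
    intro a ha
    have := hconj a ha
    unfold PowConj at this
    simp only [onePlusPow, if_true]
    rw [mul_assoc, this, ht0, inv_mul_cancel_left]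
  obtain ⟨s, d, hd, htd⟩ := Nat.exists_eq_pow_mul_and_not_dvd ht0 p hp.ne_one
  obtain ⟨⟨hs1, hs2⟩, κ, hκ, hmod⟩ := exists_coprime_pow_modEq hp ht htd hd N
  refine ⟨A, b ^ κ, s, hA, fun x hx y hy => hcomm x hx y hy, by exact_mod_cast hs1,
    fun h => by exact_mod_cast hs2 h, fun g => ?_, fun a ha => ?_⟩
  · obtain ⟨i, a, ha, rfl⟩ := hgen g
    have h3 : κ.Coprime (orderOf b) := by
      obtain ⟨k, hk⟩ := IsPGroup.iff_orderOf.1 hG.isPGroup b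
      rw [hk]
      exact (hκ.symm).pow_right k
    obtain ⟨m, hm⟩ := exists_pow_eq_self_of_coprime h3
    refine ⟨m * i, a, ha, ?_⟩
    rw [zpow_mul, zpow_natCast, hm]
  · have h := (hconj a ha).mul_pow κ
    rw [pow_eq_pow_of_modEq hmod (hN a)] at h
    have e : onePlusPow p (s : ℕ∞) = 1 + p ^ s := by
      simp [onePlusPow]
    rw [e, mul_assoc, h, inv_mul_cancel_left]

/-! ### The converse in finite groups -/

section FiniteConverse

theorem normal_closure_range_pow (H : Type*) [Group H] (n : ℕ) :
    (Subgroup.closure (Set.range fun g : H => g ^ n)).Normal := by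
  refine ⟨fun x hx g => ?_⟩
  induction hx using Subgroup.closure_induction with
  | mem x hx =>
    obtain ⟨y, rfl⟩ := hx
    refine Subgroup.subset_closure ⟨g * y * g⁻¹, ?_⟩
    simp only [conj_pow]
  | one => simp
  | mul x y _ _ hx hy =>
    have := mul_mem hx hy
    rwa [conj_mul] at this
  | inv x _ hx =>
    have := inv_mem hx
    rwa [conj_inv] at this

namespace IsModularTriple

variable {p : ℕ} {G : Type u} [Group G] {A : Subgroup G} {b : G} {s : ℕ∞}

theorem dvd_onePlusPow_sub_one (h : IsModularTriple p A b s) :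
    ∃ k, onePlusPow p s = 1 + powerfulExponent p * k := by
  have h1 := h.one_le
  have h2 := h.two_le
  induction s with
  | top => exact ⟨0, by simp [onePlusPow]⟩
  | coe s =>
    have h1' : 1 ≤ s := by exact_mod_cast h1
    have e : onePlusPow p (s : ℕ∞) = 1 + p ^ s := by simp [onePlusPow]
    suffices powerfulExponent p ∣ p ^ s by
      obtain ⟨k, hk⟩ := this
      exact ⟨k, by rw [e, hk]⟩
    unfold powerfulExponent
    split_ifs with hp
    · have h2' : 2 ≤ s := by exact_mod_cast h2 hp
      subst hp
      exact pow_dvd_pow 2 h2'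
    · exact dvd_pow_self p (by omega)

theorem map (h : IsModularTriple p A b s) {G' : Type*} [Group G'] (f : G →* G')
    (hf : Function.Surjective f) : IsModularTriple p (A.map f) (f b) s where
  normal := h.normal.map f hf
  comm := by
    rintro _ ⟨x, hx, rfl⟩ _ ⟨y, hy, rfl⟩
    rw [← map_mul, ← map_mul, h.comm x hx y hy]
  one_le := h.one_le
  two_le := h.two_le
  gen g := by
    obtain ⟨g, rfl⟩ := hf g
    obtain ⟨i, a, ha, rfl⟩ := h.gen g
    exact ⟨i, f a, ⟨a, ha, rfl⟩, by simp⟩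
  acts := by
    rintro _ ⟨x, hx, rfl⟩
    have := congrArg f (h.acts x hx)
    simpa using this

theorem exists_conj_eq [Finite G] (h : IsModularTriple p A b s) {a : G} (ha : a ∈ A) (g : G) :
    ∃ k : ℕ, g⁻¹ * a * g = a * (a ^ k) ^ powerfulExponent p := by
  obtain ⟨i, a', ha', rfl⟩ := h.gen g
  obtain ⟨i, hi⟩ : ∃ n : ℕ, b ^ n = b ^ i := by
    have := (mem_powers_iff_mem_zpowers (x := b) (y := b ^ i)).2 ⟨i, rfl⟩
    exact this
  rw [← hi]
  obtain ⟨k, hk⟩ := h.dvd_onePlusPow_sub_one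
  have hb : ∃ m : ℕ, (b ^ i)⁻¹ * a * b ^ i = a ^ (1 + powerfulExponent p * m) := by
    clear hi
    induction i with
    | zero => exact ⟨0, by simp⟩
    | succ n ih =>
      obtain ⟨m, hm⟩ := ih
      refine ⟨m + k * (1 + powerfulExponent p * m), ?_⟩
      have := h.acts _ (pow_mem ha (1 + powerfulExponent p * m))
      rw [hk, ← hm] at this
      calc _ = b⁻¹ * ((b ^ n)⁻¹ * a * b ^ n) * b := by rw [pow_succ]; group
        _ = _ := by rw [this, hm, ← pow_mul]; congr 1; ring
  obtain ⟨m, hm⟩ := hb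
  refine ⟨m, ?_⟩
  have hc := h.comm a' ha' _ (pow_mem ha (1 + powerfulExponent p * m))
  calc _ = a'⁻¹ * ((b ^ i)⁻¹ * a * b ^ i) * a' := by group
    _ = _ := by
      rw [hm, mul_assoc, ← hc, inv_mul_cancel_left, pow_add, pow_one, ← pow_mul, mul_comm m]

/-- Modulo M = H^q the elements of H ∩ A are central, as conjugation changes them by q-th powers of
elements of H. The image of H in the cyclic group G/A is cyclic, so H/M is central-by-cyclic, hence
abelian. -/
theorem commutator_mem [Finite G] (h : IsModularTriple p A b s) (H : Subgroup G) (x y : H) :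
    ⁅x, y⁆ ∈ Subgroup.closure (Set.range fun g : H => g ^ powerfulExponent p) := by
  have := h.normal
  set M := Subgroup.closure (Set.range fun g : H => g ^ powerfulExponent p) with hM
  have : M.Normal := normal_closure_range_pow H _
  have hcentral : ∀ a g : H, (a : G) ∈ A → Commute (a : H ⧸ M) g := by
    intro a g ha
    obtain ⟨k, hk⟩ := h.exists_conj_eq ha g
    have e : a * g = g * a * (a ^ k) ^ powerfulExponent p := by
      ext
      have := congrArg ((g : G) * ·) hk
      simpa [mul_assoc] using this
    have e' := congrArg (QuotientGroup.mk' M) e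
    have h1 : QuotientGroup.mk' M ((a ^ k) ^ powerfulExponent p) = 1 :=
      (QuotientGroup.eq_one_iff _).2 (Subgroup.subset_closure ⟨_, rfl⟩)
    rw [map_mul _ (g * a), h1, mul_one] at e'
    exact e'
  have hcyc : IsCyclic (G ⧸ A) := by
    refine ⟨(b : G ⧸ A), fun g => ?_⟩
    induction g using QuotientGroup.induction_on with
    | H g =>
      obtain ⟨i, a, ha, rfl⟩ := h.gen g
      refine ⟨i, ?_⟩
      simp [(QuotientGroup.eq_one_iff a).2 ha]
  obtain ⟨⟨_, h₀, hh₀, rfl⟩, hgen⟩ := Subgroup.isCyclic (H.map (QuotientGroup.mk' A))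
  have hdecomp : ∀ g : H, ∃ i : ℤ, ∃ a : H, (a : G) ∈ A ∧ g = ⟨h₀, hh₀⟩ ^ i * a := by
    intro g
    obtain ⟨i, hi⟩ := hgen ⟨QuotientGroup.mk' A g, g, g.2, rfl⟩
    refine ⟨i, (⟨h₀, hh₀⟩ ^ i)⁻¹ * g, ?_, by group⟩
    have hi' : ((h₀ : G ⧸ A)) ^ i = (g : G) := congrArg Subtype.val hi
    rw [← QuotientGroup.mk_zpow] at hi'
    simpa using QuotientGroup.eq.1 hi'
  obtain ⟨i, a, ha, rfl⟩ := hdecomp x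
  obtain ⟨j, c, hc, rfl⟩ := hdecomp y
  rw [← QuotientGroup.eq_one_iff, ← QuotientGroup.mk'_apply, map_commutatorElement,
    commutatorElement_eq_one_iff_commute]
  simp only [map_mul, map_zpow, QuotientGroup.mk'_apply]
  have hz : Commute (((⟨h₀, hh₀⟩ : H) : H ⧸ M) ^ i) (((⟨h₀, hh₀⟩ : H) : H ⧸ M) ^ j) :=
    (Commute.refl _).zpow_zpow i j
  exact (hz.mul_right ((hcentral c ⟨h₀, hh₀⟩ hc).symm.zpow_left i)).mul_left
    (((hcentral a ⟨h₀, hh₀⟩ ha).zpow_right j).mul_right (hcentral a c ha))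

end IsModularTriple

end FiniteConverse

/-! ### Passing between the pro-p group and its finite quotients -/

section Profinite

theorem isPowerful_iff {p : ℕ} (hp : p.Prime) (H : Type*) [Group H] [TopologicalSpace H]
    [IsTopologicalGroup H] :
    IsPowerful p H ↔ closedCommutator H ≤ closedPower H (powerfulExponent p) := by
  have h2 := hp.two_le
  unfold IsPowerful powerfulExponent
  split_ifs with h
  · simp [h]
  · have : 3 ≤ p := by omega
    simp [h, this]

theorem continuous_mk_openNormal {G : Type*} [Group G] [TopologicalSpace G]
    (V : OpenNormalSubgroup G) :
    Continuous (fun g : G => (g : G ⧸ V.toSubgroup)) := QuotientGroup.continuous_mk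

variable {p : ℕ} {G : Type u} [Group G] [TopologicalSpace G] [IsTopologicalGroup G]

theorem mem_closure_of_forall_openNormal [CompactSpace G] [TotallyDisconnectedSpace G]
    {S : Set G} {x : G}
    (h : ∀ V : OpenNormalSubgroup G, ∃ y ∈ S, (y : G ⧸ V.toSubgroup) = x) : x ∈ closure S := by
  rw [mem_closure_iff]
  intro O hO hx
  obtain ⟨V, hV⟩ := ProfiniteGrp.exist_openNormalSubgroup_sub_open_nhds_of_one
    (U := (fun g => x * g) ⁻¹' O) (hO.preimage (by fun_prop)) (by simpa using hx)
  obtain ⟨y, hy, hyx⟩ := h V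
  refine ⟨y, ?_, hy⟩
  have := hV (QuotientGroup.eq.1 hyx.symm)
  simpa using this

theorem eq_of_forall_openNormal [CompactSpace G] [T2Space G] [TotallyDisconnectedSpace G]
    {x y : G} (h : ∀ V : OpenNormalSubgroup G, (x : G ⧸ V.toSubgroup) = y) : x = y := by
  have := mem_closure_of_forall_openNormal (S := {x}) (x := y) fun V => ⟨x, rfl, h V⟩
  rw [closure_singleton] at this
  exact this.symm

instance (V : OpenNormalSubgroup G) : DiscreteTopology (G ⧸ V.toSubgroup) :=
  QuotientGroup.discreteTopology V.isOpen'

theorem finite_quotient_openNormal [CompactSpace G] (V : OpenNormalSubgroup G) :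
    Finite (G ⧸ V.toSubgroup) :=
  Subgroup.quotient_finite_of_isOpen _ V.isOpen'

theorem isPGroup_quotient_openNormal (hG : IsProP p G) (V : OpenNormalSubgroup G) :
    IsPGroup p (G ⧸ V.toSubgroup) := by
  obtain ⟨n, hn⟩ := hG.index_eq_pow V.toSubgroup inferInstance V.isOpen'
  exact IsPGroup.of_card hn

/-- A two-generated subgroup of the quotient pulls back to an open subgroup of G. Discreteness of
the quotient makes the closures in the definition of powerful harmless. -/
theorem isFinHerPowerful_quotient (hp : p.Prime) (hG : IsProP p G)
    (h : IsHereditarilyPowerful p G) (V : OpenNormalSubgroup G) :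
    IsFinHerPowerful p (G ⧸ V.toSubgroup) where
  prime := hp
  finite := have := hG.compactSpace; finite_quotient_openNormal V
  isPGroup := isPGroup_quotient_openNormal hG V
  commutator_mem x y := by
    set K : Subgroup (G ⧸ V.toSubgroup) := Subgroup.closure {x, y}
    set H : Subgroup G := K.comap (QuotientGroup.mk' V.toSubgroup)
    have hH : IsOpen (H : Set G) :=
      (isOpen_discrete (K : Set (G ⧸ V.toSubgroup))).preimage (continuous_mk_openNormal V)
    have hpow := (isPowerful_iff hp H).1 (h H hH)
    obtain ⟨x', rfl⟩ := QuotientGroup.mk'_surjective V.toSubgroup x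
    obtain ⟨y', rfl⟩ := QuotientGroup.mk'_surjective V.toSubgroup y
    have hx : x' ∈ H := Subgroup.subset_closure (by simp)
    have hy : y' ∈ H := Subgroup.subset_closure (by simp)
    set f : H →* G ⧸ V.toSubgroup := (QuotientGroup.mk' V.toSubgroup).comp H.subtype
    have hf : Continuous f := (continuous_mk_openNormal V).comp continuous_subtype_val
    set M := Subgroup.closure
      ((fun g => g ^ powerfulExponent p) '' (K : Set (G ⧸ V.toSubgroup))) with hM
    have hle : closedPower H (powerfulExponent p) ≤ M.comap f := by
      refine Subgroup.topologicalClosure_minimal _ ?_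
        ((isClosed_discrete (M : Set (G ⧸ V.toSubgroup))).preimage hf)
      rw [Subgroup.closure_le]
      rintro _ ⟨g, rfl⟩
      exact Subgroup.subset_closure ⟨f g, g.2, by simp⟩
    have hmem : ⁅(⟨x', hx⟩ : H), ⟨y', hy⟩⁆ ∈ closedCommutator H :=
      Subgroup.le_topologicalClosure _
        (Subgroup.commutator_mem_commutator (Subgroup.mem_top _) (Subgroup.mem_top _))
    have := hle (hpow hmem)
    rwa [Subgroup.mem_comap, map_commutatorElement] at this

theorem isModularTriple_quotient [CompactSpace G] {A : Subgroup G} {b : G} {s : ℕ∞}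
    (hA : A.Normal) (hcomm : ∀ x ∈ A, ∀ y ∈ A, x * y = y * x) (h1 : 1 ≤ s) (h2 : p = 2 → 2 ≤ s)
    (hgen : ((Subgroup.zpowers b).topologicalClosure : Set G) * (A : Set G) = Set.univ)
    (hacts : ActsAsOnePlusPow p b A s) (V : OpenNormalSubgroup G) :
    IsModularTriple p (A.map (QuotientGroup.mk' V.toSubgroup)) (b : G ⧸ V.toSubgroup) s where
  normal := hA.map _ (QuotientGroup.mk'_surjective _)
  comm := by
    rintro _ ⟨x, hx, rfl⟩ _ ⟨y, hy, rfl⟩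
    rw [← map_mul, ← map_mul, hcomm x hx y hy]
  one_le := h1
  two_le := h2
  gen g := by
    obtain ⟨g, rfl⟩ := QuotientGroup.mk'_surjective _ g
    obtain ⟨c, hc, a, ha, rfl⟩ := Set.mem_mul.1 (hgen ▸ Set.mem_univ g)
    have hle : (Subgroup.zpowers b).topologicalClosure ≤
        (Subgroup.zpowers (b : G ⧸ V.toSubgroup)).comap (QuotientGroup.mk' V.toSubgroup) := by
      refine Subgroup.topologicalClosure_minimal _ ?_
        ((isClosed_discrete (Subgroup.zpowers (b : G ⧸ V.toSubgroup) :
          Set (G ⧸ V.toSubgroup))).preimage (continuous_mk_openNormal V))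
      rw [Subgroup.zpowers_le]
      exact Subgroup.mem_zpowers _
    obtain ⟨i, hi⟩ := hle hc
    exact ⟨i, a, ⟨a, ha, rfl⟩, by rw [map_mul]; exact congrArg (· * _) hi.symm⟩
  acts := by
    rintro _ ⟨x, hx, rfl⟩
    have := congrArg (QuotientGroup.mk' V.toSubgroup) (hacts x hx)
    simpa using this

theorem isHereditarilyPowerful_of_forall_quotient (hp : p.Prime) [CompactSpace G]
    [TotallyDisconnectedSpace G] {A : Subgroup G} {b : G} {s : ℕ∞}
    (h : ∀ V : OpenNormalSubgroup G, IsModularTriple p (A.map (QuotientGroup.mk' V.toSubgroup))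
      (b : G ⧸ V.toSubgroup) s) : IsHereditarilyPowerful p G := by
  intro H hH
  rw [isPowerful_iff hp]
  refine Subgroup.topologicalClosure_minimal _ ?_ (Subgroup.isClosed_topologicalClosure _)
  rw [commutator_def, Subgroup.commutator_le]
  intro x _ y _
  rw [closedPower, ← SetLike.mem_coe, Subgroup.topologicalClosure_coe, closure_subtype]
  refine mem_closure_of_forall_openNormal fun V => ?_
  have := finite_quotient_openNormal V
  set π := QuotientGroup.mk' V.toSubgroup
  have hmem := (h V).commutator_mem (H.map π) ⟨π x, x, x.2, rfl⟩ ⟨π y, y, y.2, rfl⟩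
  set f : H →* H.map π := π.subgroupMap H
  have hle : Subgroup.closure (Set.range fun g : H.map π => g ^ powerfulExponent p) ≤
      (Subgroup.closure (Set.range fun g : H => g ^ powerfulExponent p)).map f := by
    rw [Subgroup.closure_le]
    rintro _ ⟨⟨_, g, hg, rfl⟩, rfl⟩
    exact ⟨⟨g, hg⟩ ^ powerfulExponent p, Subgroup.subset_closure ⟨_, rfl⟩, rfl⟩
  obtain ⟨z, hz, hzeq⟩ := hle hmem
  exact ⟨z, ⟨z, hz, rfl⟩, congrArg Subtype.val hzeq⟩

end Profinite

/-! ### Limits of triples along an ultrafilter -/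

section Limit

variable {p : ℕ} {G : Type u} [Group G] [TopologicalSpace G]

/-- The limit of subgroups `A i` along a filter: the elements that, modulo every open normal
subgroup, eventually lie in `A i`. -/
def limitSubgroup {ι : Type*} (F : Filter ι) (A : ι → Subgroup G) : Subgroup G :=
  ⨅ V : OpenNormalSubgroup G,
    { carrier := {x | ∀ᶠ i in F, (x : G ⧸ V.toSubgroup) ∈ (A i).map (QuotientGroup.mk' V.toSubgroup)}
      one_mem' := Eventually.of_forall fun _ => one_mem _
      mul_mem' := fun hx hy => by
        filter_upwards [hx, hy] with i hx hy using mul_mem hx hy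
      inv_mem' := fun hx => by
        filter_upwards [hx] with i hx using inv_mem hx }

theorem mem_limitSubgroup {ι : Type*} {F : Filter ι} {A : ι → Subgroup G} {x : G} :
    x ∈ limitSubgroup F A ↔ ∀ V : OpenNormalSubgroup G,
      ∀ᶠ i in F, (x : G ⧸ V.toSubgroup) ∈ (A i).map (QuotientGroup.mk' V.toSubgroup) := by
  rw [limitSubgroup, Subgroup.mem_iInf]
  rfl

variable [IsTopologicalGroup G]

theorem isClosed_limitSubgroup {ι : Type*} (F : Filter ι) (A : ι → Subgroup G) :
    IsClosed (limitSubgroup F A : Set G) := by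
  have : (limitSubgroup F A : Set G) = ⋂ V : OpenNormalSubgroup G,
      (fun g : G => (g : G ⧸ V.toSubgroup)) ⁻¹'
        {y | ∀ᶠ i in F, y ∈ (A i).map (QuotientGroup.mk' V.toSubgroup)} := by
    ext x
    rw [SetLike.mem_coe, mem_limitSubgroup, Set.mem_iInter]
    rfl
  rw [this]
  exact isClosed_iInter fun V => (isClosed_discrete _).preimage (continuous_mk_openNormal V)

theorem tendsto_mk_openNormal {ι : Type*} {F : Filter ι} {x : ι → G} {y : G}
    (h : Tendsto x F (𝓝 y)) (V : OpenNormalSubgroup G) :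
    ∀ᶠ i in F, (x i : G ⧸ V.toSubgroup) = y := by
  have := ((continuous_mk_openNormal V).tendsto y).comp h
  rw [nhds_discrete, tendsto_pure] at this
  exact this

/-- If s₀ is infinite, p^(s i) eventually kills the finite p-group Q; if s₀ is finite, it is
isolated in ℕ∞ and s i is eventually equal to it. -/
theorem eventually_pow_onePlusPow_eq {ι : Type*} {F : Filter ι} {s : ι → ℕ∞} {s₀ : ℕ∞}
    (h : Tendsto s F (𝓝 s₀)) {Q : Type*} [Group Q] [Finite Q] (hQ : IsPGroup p Q)
    [Fact p.Prime] :
    ∀ᶠ i in F, ∀ g : Q, g ^ onePlusPow p (s i) = g ^ onePlusPow p s₀ := by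
  by_cases hs : s₀ = ⊤
  · subst hs
    obtain ⟨n, hn⟩ := IsPGroup.iff_card.1 hQ
    have h1 : ∀ᶠ i in F, (n : ℕ∞) < s i := h.eventually (lt_mem_nhds (ENat.natCast_lt_top n))
    filter_upwards [h1] with i hi g
    by_cases h2 : s i = ⊤
    · rw [h2]
    · have h3 : n ≤ (s i).toNat := by
        have h4 := ENat.natCast_toNat h2
        rw [← h4] at hi
        exact_mod_cast hi.le
      have h5 : g ^ p ^ (s i).toNat = 1 :=
        orderOf_dvd_iff_pow_eq_one.1 ((orderOf_dvd_natCard g).trans (hn ▸ pow_dvd_pow p h3))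
      rw [onePlusPow, if_neg h2, onePlusPow, if_pos rfl, pow_add, h5, mul_one]
  · have h1 : ∀ᶠ i in F, s i ∈ ({s₀} : Set ℕ∞) :=
      h.eventually ((ENat.isOpen_singleton hs).mem_nhds rfl)
    filter_upwards [h1] with i hi g
    rw [Set.mem_singleton_iff.1 hi]

theorem exists_modular_of_forall_quotient (hp : p.Prime) (hG : IsProP p G)
    (h : ∀ V : OpenNormalSubgroup G, ∃ (A : Subgroup (G ⧸ V.toSubgroup)) (b : G ⧸ V.toSubgroup)
      (s : ℕ∞), IsModularTriple p A b s) :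
    ∃ (A : Subgroup G) (b : G) (s : ℕ∞),
      IsClosed (A : Set G) ∧ A.Normal ∧ (∀ x ∈ A, ∀ y ∈ A, x * y = y * x) ∧
      1 ≤ s ∧ (p = 2 → 2 ≤ s) ∧
      ((Subgroup.zpowers b).topologicalClosure : Set G) * (A : Set G) = Set.univ ∧
      ActsAsOnePlusPow p b A s := by
  have := hG.compactSpace
  have := hG.t2Space
  have := hG.totallyDisconnectedSpace
  have := Fact.mk hp
  have hchoice : ∀ U : OpenNormalSubgroup G, ∃ (A : Subgroup G) (b : G) (s : ℕ∞),
      U.toSubgroup ≤ A ∧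
      IsModularTriple p (A.map (QuotientGroup.mk' U.toSubgroup)) (b : G ⧸ U.toSubgroup) s := by
    intro U
    obtain ⟨A, b, s, hA⟩ := h U
    obtain ⟨b, rfl⟩ := QuotientGroup.mk'_surjective _ b
    refine ⟨A.comap (QuotientGroup.mk' U.toSubgroup), b, s, ?_, ?_⟩
    · intro x hx
      rw [Subgroup.mem_comap, QuotientGroup.mk'_apply, (QuotientGroup.eq_one_iff x).2 hx]
      exact one_mem A
    · rwa [Subgroup.map_comap_eq_self_of_surjective (QuotientGroup.mk'_surjective _)]
  choose A b s hUA hU using hchoice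
  have htriple : ∀ U V : OpenNormalSubgroup G, U ≤ V →
      IsModularTriple p ((A U).map (QuotientGroup.mk' V.toSubgroup)) (b U : G ⧸ V.toSubgroup)
        (s U) := by
    intro U V hUV
    have := (hU U).map (QuotientGroup.map U.toSubgroup V.toSubgroup (MonoidHom.id G) hUV)
      (QuotientGroup.map_surjective_of_surjective _ _ _ (QuotientGroup.mk_surjective) _)
    rw [Subgroup.map_map] at this
    exact this
  have : Nonempty (OpenNormalSubgroup G) :=
    ⟨(ProfiniteGrp.exist_openNormalSubgroup_sub_open_nhds_of_one isOpen_univ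
      (Set.mem_univ (1 : G))).choose⟩
  -- Refining `atBot` makes U ≤ V hold eventually for each fixed V; being an ultrafilter, F has
  -- limits in every compact space.
  set F : Ultrafilter (OpenNormalSubgroup G) := Ultrafilter.of atBot
  have hle : ∀ V : OpenNormalSubgroup G, ∀ᶠ U in (F : Filter (OpenNormalSubgroup G)), U ≤ V :=
    fun V => (eventually_le_atBot V).filter_mono (Ultrafilter.of_le _)
  have hlim : ∀ {X : Type u} [TopologicalSpace X] [CompactSpace X]
      (x : OpenNormalSubgroup G → X), ∃ y, Tendsto x F (𝓝 y) := by
    intro X _ _ x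
    obtain ⟨y, -, hy⟩ := isCompact_univ.ultrafilter_le_nhds (F.map x) (by simp)
    exact ⟨y, hy⟩
  obtain ⟨b₀, hb₀⟩ := hlim b
  obtain ⟨s₀, hs₀⟩ : ∃ s₀, Tendsto s F (𝓝 s₀) := by
    obtain ⟨y, -, hy⟩ := isCompact_univ.ultrafilter_le_nhds (F.map s) (by simp)
    exact ⟨y, hy⟩
  refine ⟨limitSubgroup F A, b₀, s₀, isClosed_limitSubgroup _ _, ⟨fun x hx g => ?_⟩,
    fun x hx y hy => ?_, ?_, fun h2 => ?_, ?_, fun x hx => ?_⟩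
  · rw [mem_limitSubgroup] at hx ⊢
    intro V
    filter_upwards [hx V, hle V] with U hxU hUV
    exact (htriple U V hUV).normal.conj_mem _ hxU g
  · refine eq_of_forall_openNormal fun V => ?_
    obtain ⟨U, hxU, hyU, hUV⟩ :=
      ((mem_limitSubgroup.1 hx V).and ((mem_limitSubgroup.1 hy V).and (hle V))).exists
    exact (htriple U V hUV).comm _ hxU _ hyU
  · exact ge_of_tendsto hs₀ (Eventually.of_forall fun U => (hU U).one_le)
  · exact ge_of_tendsto hs₀ (Eventually.of_forall fun U => (hU U).two_le h2)
  · refine Set.eq_univ_of_forall fun g => ?_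
    have hgen : ∀ U, ∃ i : ℤ, (b U ^ i)⁻¹ * g ∈ A U := by
      intro U
      obtain ⟨i, _, ⟨a, ha, rfl⟩, hi⟩ := (hU U).gen g
      refine ⟨i, ?_⟩
      have : (g : G ⧸ U.toSubgroup) = ((b U ^ i * a : G) : G ⧸ U.toSubgroup) := hi
      have h1 := hUA U (QuotientGroup.eq.1 this.symm)
      have h2 := mul_mem ha h1
      rwa [mul_inv_rev, mul_assoc, mul_inv_cancel_left] at h2
    choose i hi using hgen
    -- The exponents i U need not converge, but the elements b U ^ i U do, and their limit lies in
    -- the closure of the powers of b₀.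
    obtain ⟨c, hc⟩ := hlim fun U => b U ^ i U
    refine Set.mem_mul.2 ⟨c, ?_, c⁻¹ * g, ?_, by group⟩
    · refine mem_closure_of_forall_openNormal fun V => ?_
      obtain ⟨U, h1, h2⟩ :=
        ((tendsto_mk_openNormal hb₀ V).and (tendsto_mk_openNormal hc V)).exists
      refine ⟨b₀ ^ i U, ⟨i U, rfl⟩, ?_⟩
      rw [← h2, QuotientGroup.mk_zpow, QuotientGroup.mk_zpow, h1]
    · rw [SetLike.mem_coe, mem_limitSubgroup]
      intro V
      filter_upwards [tendsto_mk_openNormal hc V] with U h2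
      refine ⟨_, hi U, ?_⟩
      rw [QuotientGroup.mk'_apply, QuotientGroup.mk_mul, QuotientGroup.mk_mul,
        QuotientGroup.mk_inv, QuotientGroup.mk_inv, h2]
  · refine eq_of_forall_openNormal fun V => ?_
    have := finite_quotient_openNormal V
    obtain ⟨U, hxU, hUV, hb, hs⟩ := ((mem_limitSubgroup.1 hx V).and ((hle V).and
      ((tendsto_mk_openNormal hb₀ V).and
        (eventually_pow_onePlusPow_eq hs₀ (isPGroup_quotient_openNormal hG V))))).exists
    have := (htriple U V hUV).acts _ hxU
    rw [hs, hb] at this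
    exact this

end Limit

theorem theorem1p11 (p : ℕ) (hp : p.Prime) (G : Type*) [Group G] [TopologicalSpace G]
    [IsTopologicalGroup G] (hG : IsProP p G) (hfg : IsTopologicallyFG G) :
    IsHereditarilyPowerful p G ↔
      ∃ (A : Subgroup G) (b : G) (s : ℕ∞),
        IsClosed (A : Set G) ∧ A.Normal ∧ (∀ x ∈ A, ∀ y ∈ A, x * y = y * x) ∧
        1 ≤ s ∧ (p = 2 → 2 ≤ s) ∧
        ((Subgroup.zpowers b).topologicalClosure : Set G) * (A : Set G) = Set.univ ∧
        ActsAsOnePlusPow p b A s := by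
  have := hG.compactSpace
  have := hG.totallyDisconnectedSpace
  constructor
  · intro h
    exact exists_modular_of_forall_quotient hp hG fun V =>
      (isFinHerPowerful_quotient hp hG h V).exists_isModularTriple
  · rintro ⟨A, b, s, -, hA, hcomm, h1, h2, hgen, hacts⟩
    exact isHereditarilyPowerful_of_forall_quotient hp
      (isModularTriple_quotient hA hcomm h1 h2 hgen hacts)
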